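/- Let $K$ be a field and $S=K[x_1,\dots,x_n]$ with $n\ge 1$. For a homogeneous ideal $I\subseteq S$ let $I_d$ be the $K$-vector space of forms of degree $d$ in $I$, and for a subspace $V\subseteq S_d$ let $\mathbf m_1V\subseteq S_{d+1}$ be the span of all products $x_i f$ with $1\le i\le n$, $f\in V$. A homogeneous ideal $I$ is \emph{Gotzmann} if for all $d\ge 0$ and all homogeneous ideals $J\subseteq S$ with $\dim_K J_d=\dim_K I_d$ we have $\dim_K\mathbf m_1I_d\le\dim_K\mathbf m_1J_d$. An ideal is \emph{squarefree} if it is a monomial ideal all of whose minimal monomial generators are squarefree (the ideals $(0)$ and $(1)$ are squarefree). We say that a monomial ideal is \emph{contained in a monomial subalgebra} if all of its minimal monomial generators lie in $K[x_i : i\in A]$ for some proper subset $A\subsetneq\{1,\dots,n\}$. Ideals are counted up to a reordering of the variables: $I$ and $J$ are identified if some permutation of the variables carries $I$ onto $J$. A linear form means a nonzero homogeneous polynomial of degree $1$. If $n\ge 2$, each of the following numbers equals $2^{n-2}$: (i) the number of ordered partitions (compositions) of $n$ into an even number of positive summands; (ii) the number of ordered partitions of $n$ into an odd number of positive summands; (iii)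 the number, up to reordering, of squarefree Gotzmann ideals of $S$ that contain no linear form and are not contained in any monomial subalgebra; (iv) the number, up to reordering, of nonunit squarefree Gotzmann ideals of $S$ that contain a linear form and are not contained in any monomial subalgebra; (v) the number, up to reordering, of squarefree Gotzmann ideals of $S$ that contain no linear form and are contained in some monomial subalgebra; (vi) the number, up to reordering, of nonunit squarefree Gotzmann ideals of $S$ that contain a linear form and are contained in some monomial subalgebra. Moreover, for every $n\ge 1$ there are exactly $2^n$ nonunit squarefree Gotzmann ideals of $S$ up to reordering of the variables. -/

import Mathlib

namespace SqfGotzmann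

open MvPolynomial

attribute [local instance] MvPolynomial.gradedAlgebra

variable {K : Type*} [Field K] {n : ℕ}

/-- The vector space `I_d` of forms of degree `d` in the ideal `I` of `S = K[x_1, …, x_n]`. -/
noncomputable def component (I : Ideal (MvPolynomial (Fin n) K)) (d : ℕ) :
    Submodule K (MvPolynomial (Fin n) K) :=
  I.restrictScalars K ⊓ homogeneousSubmodule (Fin n) K d

/-- `𝐦₁ V`: the span of all products of a linear form with an element of `V`. -/
noncomputable def growth (V : Submodule K (MvPolynomial (Fin n) K)) :
    Submodule K (MvPolynomial (Fin n) K) :=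
  homogeneousSubmodule (Fin n) K 1 * V

/-- A homogeneous ideal `I` is Gotzmann if, for every degree `d` and every homogeneous ideal `J`
with `dim J_d = dim I_d`, one has `dim 𝐦₁ I_d ≤ dim 𝐦₁ J_d`. (All these spaces are
finite-dimensional.) -/
def IsGotzmann (I : Ideal (MvPolynomial (Fin n) K)) : Prop :=
  I.IsHomogeneous (homogeneousSubmodule (Fin n) K) ∧
    ∀ (d : ℕ) (J : Ideal (MvPolynomial (Fin n) K)),
      J.IsHomogeneous (homogeneousSubmodule (Fin n) K) →
      Module.finrank K (component I d) = Module.finrank K (component J d) →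
      Module.finrank K (growth (component I d)) ≤ Module.finrank K (growth (component J d))

/-- A monomial ideal is an ideal with a generating set consisting of monomials. -/
def IsMonomialIdeal (I : Ideal (MvPolynomial (Fin n) K)) : Prop :=
  ∃ A : Set (Fin n →₀ ℕ), I = Ideal.span ((fun a => monomial a (1 : K)) '' A)

/-- The exponent vectors of the canonical minimal monomial generators of a monomial ideal:
the monomials in `I` that are minimal with respect to divisibility. -/
def gens (I : Ideal (MvPolynomial (Fin n) K)) : Set (Fin n →₀ ℕ) :=
  {a | Minimal (fun b : Fin n →₀ ℕ => monomial b (1 : K) ∈ I) a}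

/-- A squarefree ideal: a monomial ideal whose minimal monomial generators are squarefree. -/
def IsSquarefreeIdeal (I : Ideal (MvPolynomial (Fin n) K)) : Prop :=
  IsMonomialIdeal I ∧ ∀ a ∈ gens I, ∀ i, a i ≤ 1

/-- The ideal contains a (nonzero) linear form. -/
def HasLinearForm (I : Ideal (MvPolynomial (Fin n) K)) : Prop :=
  ∃ f ∈ I, f ≠ 0 ∧ f.IsHomogeneous 1

/-- The minimal monomial generators of `I` all lie in the subalgebra `K[x_i : i ∈ A]` for some
proper subset `A` of the variables, i.e. `I` is the extension of an ideal of a polynomial ring in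
fewer of the variables. -/
def InMonomialSubalgebra (I : Ideal (MvPolynomial (Fin n) K)) : Prop :=
  ∃ A : Set (Fin n), A ≠ Set.univ ∧ ∀ a ∈ gens I, monomial a (1 : K) ∈ supported K A

/-- Two ideals are equivalent if a reordering of the variables carries one to the other. -/
def reorderingSetoid (K : Type*) [Field K] (n : ℕ) :
    Setoid (Ideal (MvPolynomial (Fin n) K)) where
  r I J := ∃ σ : Equiv.Perm (Fin n), J = I.map (renameEquiv K σ)
  iseqv :=
    { refl := fun I => ⟨1, by
        have h : ((renameEquiv K (1 : Equiv.Perm (Fin n)) :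
            MvPolynomial (Fin n) K ≃ₐ[K] MvPolynomial (Fin n) K)) = AlgEquiv.refl :=
          renameEquiv_refl K
        rw [h]
        exact (Ideal.map_id I).symm⟩
      symm := by
        rintro I J ⟨σ, rfl⟩
        refine ⟨σ.symm, ?_⟩
        rw [← renameEquiv_symm]
        exact (Ideal.map_of_equiv (renameEquiv K σ).toRingEquiv).symm
      trans := by
        rintro I J L ⟨σ, rfl⟩ ⟨τ, rfl⟩
        refine ⟨σ.trans τ, ?_⟩
        rw [← renameEquiv_trans]
        exact Ideal.map_map (renameEquiv K σ).toRingEquiv.toRingHom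
          (renameEquiv K τ).toRingEquiv.toRingHom }

/-- The number of ideals in the class `C`, up to reordering of the variables. -/
noncomputable def countUpToReordering (C : Set (Ideal (MvPolynomial (Fin n) K))) : ℕ :=
  (Quotient.mk (reorderingSetoid K n) '' C).ncard

end SqfGotzmann

namespace SqfGotzmann

open Finset

/-! ### Monomials of a given degree and their upper shadow -/

/-! For a monomial ideal the Gotzmann condition is combinatorial. Passing to leading monomials keeps
dimensions and can only lower the growth, so the condition says that in every degree the monomials
of the ideal have the smallest upper shadow among all sets of their size (`Opt`,
`isGotzmann_span_iff`). By Macaulay's theorem (`macaulay`) that minimum is attained by lexicographic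
segments. A squarefree ideal is encoded by the up-closed family `F` of supports of its monomials;
setting a variable to zero or to one gives the deletion `del` and the link `lk`.

The classification rests on a dichotomy. If the ideal contains a variable, it is Gotzmann exactly
when the deletion of that variable is (`gotz_iff_of_singleton`). If it is proper and contains no
variable, exchange arguments show that all its members share a variable (`exists_common_variable`),
so it is that variable times its link, and the link is again Gotzmann (`Gotz.lk`). Hence every
nonunit squarefree Gotzmann ideal arises from the zero ideal by `n` choices between adjoining a new
variable as a generator and multiplying by a new variable: a word of `n` binary digits, that is,
`fam n k` with `k < 2 ^ n` (`Gotz.exists_fam`). Conversely all of these are Gotzmann (`gotz_fam`).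

The ideal of `fam n k` contains exactly `k` squarefree monomials (`famCard_fam`), so this number is
a complete invariant up to reordering and takes each value below `2 ^ n`. The leading digit decides
whether there is a linear form, and the parity of `k` decides whether some variable is not needed.
For `n ≥ 2` these are two different digits, and prescribing both leaves `2 ^ (n - 2)` ideals.
Compositions of `n` are subsets of the `n - 1` interior cut points, and half of those have even
size. -/

/-- The exponent vectors of the monomials of degree `d` in `n` variables. -/
def mons (n d : ℕ) : Finset (Fin n → ℕ) := piAntidiag univ d

theorem mem_mons {n d : ℕ} {u : Fin n → ℕ} : u ∈ mons n d ↔ ∑ i, u i = d := by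
  simp [mons]

/-- The upper shadow: all products of a member of `A` with a variable. -/
def up {n : ℕ} (A : Finset (Fin n → ℕ)) : Finset (Fin n → ℕ) :=
  univ.biUnion fun i => A.image fun u => u + Pi.single i 1

theorem mem_up {n : ℕ} {A : Finset (Fin n → ℕ)} {w : Fin n → ℕ} :
    w ∈ up A ↔ ∃ u ∈ A, ∃ i, w = u + Pi.single i 1 := by
  simp only [up, mem_biUnion, mem_univ, true_and, mem_image]
  constructor
  · rintro ⟨i, u, hu, rfl⟩; exact ⟨u, hu, i, rfl⟩
  · rintro ⟨u, hu, i, rfl⟩; exact ⟨i, u, hu, rfl⟩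

theorem add_single_mem_up {n : ℕ} {A : Finset (Fin n → ℕ)} {u : Fin n → ℕ} (hu : u ∈ A)
    (i : Fin n) : u + Pi.single i 1 ∈ up A := mem_up.2 ⟨u, hu, i, rfl⟩

theorem up_mono {n : ℕ} {A B : Finset (Fin n → ℕ)} (h : A ⊆ B) : up A ⊆ up B := by
  intro w hw
  obtain ⟨u, hu, i, rfl⟩ := mem_up.1 hw
  exact add_single_mem_up (h hu) i

@[simp] theorem up_empty {n : ℕ} : up (∅ : Finset (Fin n → ℕ)) = ∅ := by
  ext w; simp [mem_up]

theorem sum_add_single {n : ℕ} (u : Fin n → ℕ) (i : Fin n) :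
    ∑ k, (u + Pi.single i 1 : Fin n → ℕ) k = ∑ k, u k + 1 := by
  simp [sum_add_distrib]

theorem add_single_mem_mons {n d : ℕ} {u : Fin n → ℕ} {i : Fin n} :
    u + Pi.single i 1 ∈ mons n (d + 1) ↔ u ∈ mons n d := by
  rw [mem_mons, mem_mons, sum_add_single]; omega

theorem up_subset_mons {n d : ℕ} {A : Finset (Fin n → ℕ)} (h : A ⊆ mons n d) :
    up A ⊆ mons n (d + 1) := by
  intro w hw
  obtain ⟨u, hu, i, rfl⟩ := mem_up.1 hw
  exact add_single_mem_mons.2 (h hu)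

theorem exists_eq_add_single {n : ℕ} {u : Fin n → ℕ} {i : Fin n} (h : u i ≠ 0) :
    ∃ v : Fin n → ℕ, u = v + Pi.single i 1 := by
  refine ⟨u - Pi.single i 1, ?_⟩
  ext k
  by_cases hk : k = i
  · subst hk; simp; omega
  · simp [hk]

theorem exists_ne_zero_of_mem_mons_succ {n d : ℕ} {u : Fin n → ℕ} (h : u ∈ mons n (d + 1)) :
    ∃ i, u i ≠ 0 := by
  by_contra! hc
  rw [mem_mons] at h
  simp [hc] at h

theorem up_mons (n d : ℕ) : up (mons n d) = mons n (d + 1) := by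
  refine (up_subset_mons subset_rfl).antisymm fun w hw => ?_
  obtain ⟨i, hi⟩ := exists_ne_zero_of_mem_mons_succ hw
  obtain ⟨v, rfl⟩ := exists_eq_add_single hi
  exact add_single_mem_up (add_single_mem_mons.1 hw) i

theorem mons_zero_right (n : ℕ) : mons n 0 = {0} := by
  simp [mons]

/-! ### Splitting off one variable -/

/-- Insert the exponent `j` at position `p`. -/
def ins {n : ℕ} (p : Fin (n + 1)) (j : ℕ) (v : Fin n → ℕ) : Fin (n + 1) → ℕ :=
  Fin.insertNth (α := fun _ => ℕ) p j v

@[simp] theorem ins_self {n : ℕ} (p : Fin (n + 1)) (j : ℕ) (v : Fin n → ℕ) : ins p j v p = j :=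
  Fin.insertNth_apply_same (α := fun _ => ℕ) p j v

@[simp] theorem ins_succAbove {n : ℕ} (p : Fin (n + 1)) (j : ℕ) (v : Fin n → ℕ) (i : Fin n) :
    ins p j v (p.succAbove i) = v i :=
  Fin.insertNth_apply_succAbove (α := fun _ => ℕ) p j v i

@[simp] theorem ins_zero_succ {n : ℕ} (j : ℕ) (v : Fin n → ℕ) (i : Fin n) :
    ins 0 j v i.succ = v i := by
  rw [← Fin.succAbove_zero_apply]; exact ins_succAbove _ _ _ _

@[simp] theorem ins_last_castSucc {n : ℕ} (j : ℕ) (v : Fin n → ℕ) (i : Fin n) :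
    ins (Fin.last n) j v i.castSucc = v i := by
  rw [← Fin.succAbove_last_apply]; exact ins_succAbove _ _ _ _

theorem eq_ins {n : ℕ} (p : Fin (n + 1)) (u : Fin (n + 1) → ℕ) :
    u = ins p (u p) fun i => u (p.succAbove i) := by
  ext k
  rcases p.eq_self_or_eq_succAbove k with rfl | ⟨i, rfl⟩ <;> simp

theorem ins_inj {n : ℕ} {p : Fin (n + 1)} {j k : ℕ} {v w : Fin n → ℕ} :
    ins p j v = ins p k w ↔ j = k ∧ v = w := by
  constructor
  · intro h
    refine ⟨by simpa using congrFun h p, ?_⟩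
    ext i
    simpa using congrFun h (p.succAbove i)
  · rintro ⟨rfl, rfl⟩; rfl

theorem ins_add_single_self {n : ℕ} (p : Fin (n + 1)) (j : ℕ) (v : Fin n → ℕ) :
    ins p j v + Pi.single p 1 = ins p (j + 1) v := by
  ext k
  rcases p.eq_self_or_eq_succAbove k with rfl | ⟨i, rfl⟩ <;> simp

theorem ins_add_single_succAbove {n : ℕ} (p : Fin (n + 1)) (j : ℕ) (v : Fin n → ℕ) (i : Fin n) :
    ins p j v + Pi.single (p.succAbove i) 1 = ins p j (v + Pi.single i 1) := by
  ext k
  rcases p.eq_self_or_eq_succAbove k with rfl | ⟨m, rfl⟩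
  · simp [(Fin.succAbove_ne _ _).symm]
  · simp [Pi.single_apply]

theorem ins_mem_mons {n d : ℕ} {p : Fin (n + 1)} {j : ℕ} {v : Fin n → ℕ} :
    ins p j v ∈ mons (n + 1) d ↔ j + ∑ i, v i = d := by
  rw [mem_mons, Fin.sum_univ_succAbove _ p]; simp

/-- The members of `A` whose exponent at `p` is `j`, with that exponent removed. -/
def lev {n : ℕ} (p : Fin (n + 1)) (j : ℕ) (A : Finset (Fin (n + 1) → ℕ)) : Finset (Fin n → ℕ) :=
  (A.filter fun u => u p = j).image fun u i => u (p.succAbove i)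

@[simp] theorem mem_lev {n : ℕ} {p : Fin (n + 1)} {j : ℕ} {A : Finset (Fin (n + 1) → ℕ)}
    {v : Fin n → ℕ} : v ∈ lev p j A ↔ ins p j v ∈ A := by
  simp only [lev, mem_image, mem_filter]
  constructor
  · rintro ⟨u, ⟨hu, rfl⟩, rfl⟩
    rwa [← eq_ins]
  · intro h
    exact ⟨_, ⟨h, ins_self _ _ _⟩, by ext; simp⟩

theorem card_lev {n : ℕ} (p : Fin (n + 1)) (j : ℕ) (A : Finset (Fin (n + 1) → ℕ)) :
    (lev p j A).card = (A.filter fun u => u p = j).card := by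
  refine card_image_of_injOn fun u hu w hw h => ?_
  rw [eq_ins p u, eq_ins p w, ins_inj]
  simp only [coe_filter, Set.mem_ofPred_eq] at hu hw
  exact ⟨hu.2.trans hw.2.symm, h⟩

theorem apply_le_of_mem_mons {n d : ℕ} {u : Fin n → ℕ} (h : u ∈ mons n d) (i : Fin n) :
    u i ≤ d := by
  rw [mem_mons] at h
  exact h ▸ single_le_sum (f := u) (fun _ _ => Nat.zero_le _) (mem_univ i)

theorem card_eq_sum_lev {n d m : ℕ} (p : Fin (n + 1)) {A : Finset (Fin (n + 1) → ℕ)}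
    (h : A ⊆ mons (n + 1) d) (hm : d < m) : A.card = ∑ j ∈ range m, (lev p j A).card := by
  simp_rw [card_lev]
  refine card_eq_sum_card_fiberwise fun u hu => ?_
  simpa using (apply_le_of_mem_mons (h hu) p).trans_lt hm

theorem lev_subset_mons {n d : ℕ} {p : Fin (n + 1)} {A : Finset (Fin (n + 1) → ℕ)}
    (h : A ⊆ mons (n + 1) d) (j : ℕ) : lev p j A ⊆ mons n (d - j) := by
  intro v hv
  have := ins_mem_mons.1 (h (mem_lev.1 hv))
  rw [mem_mons]; omega

theorem lev_eq_empty {n d : ℕ} {p : Fin (n + 1)} {A : Finset (Fin (n + 1) → ℕ)}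
    (h : A ⊆ mons (n + 1) d) {j : ℕ} (hj : d < j) : lev p j A = ∅ := by
  refine eq_empty_of_forall_notMem fun v hv => ?_
  have := ins_mem_mons.1 (h (mem_lev.1 hv))
  omega

theorem ins_mem_up {n : ℕ} {p : Fin (n + 1)} {A : Finset (Fin (n + 1) → ℕ)} {j : ℕ}
    {v : Fin n → ℕ} : ins p j v ∈ up A ↔ v ∈ up (lev p j A) ∨ ∃ k, j = k + 1 ∧ ins p k v ∈ A := by
  rw [mem_up]
  constructor
  · rintro ⟨u, hu, i, h⟩
    rw [eq_ins p u] at h hu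
    rcases p.eq_self_or_eq_succAbove i with rfl | ⟨m, rfl⟩
    · rw [ins_add_single_self, ins_inj] at h
      obtain ⟨rfl, rfl⟩ := h
      exact Or.inr ⟨_, rfl, hu⟩
    · rw [ins_add_single_succAbove, ins_inj] at h
      obtain ⟨rfl, rfl⟩ := h
      exact Or.inl (add_single_mem_up (mem_lev.2 hu) m)
  · rintro (h | ⟨k, rfl, h⟩)
    · obtain ⟨w, hw, i, rfl⟩ := mem_up.1 h
      exact ⟨_, mem_lev.1 hw, p.succAbove i, (ins_add_single_succAbove _ _ _ _).symm⟩
    · exact ⟨_, h, p, (ins_add_single_self _ _ _).symm⟩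

theorem lev_zero_up {n : ℕ} (p : Fin (n + 1)) (A : Finset (Fin (n + 1) → ℕ)) :
    lev p 0 (up A) = up (lev p 0 A) := by
  ext v; simp [ins_mem_up]

theorem lev_succ_up {n : ℕ} (p : Fin (n + 1)) (j : ℕ) (A : Finset (Fin (n + 1) → ℕ)) :
    lev p (j + 1) (up A) = lev p j A ∪ up (lev p (j + 1) A) := by
  ext v; simp [ins_mem_up, or_comm]

/-- A monomial of the shadow with positive exponent at `p` comes either from multiplying by `p`, out
of the level below, or from another variable, inside its own level. All inductions on the number of
variables start from this formula. -/
theorem card_up_eq {n d : ℕ} (p : Fin (n + 1)) {A : Finset (Fin (n + 1) → ℕ)}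
    (h : A ⊆ mons (n + 1) d) :
    (up A).card = ∑ j ∈ range (d + 1), (lev p j A ∪ up (lev p (j + 1) A)).card +
      (up (lev p 0 A)).card := by
  rw [card_eq_sum_lev p (up_subset_mons h) (lt_add_one _), sum_range_succ', lev_zero_up]
  simp_rw [lev_succ_up]

/-- The monomials of degree `d` whose levels at `p` are prescribed. -/
def ofLevs {n : ℕ} (p : Fin (n + 1)) (d : ℕ) (N : ℕ → Finset (Fin n → ℕ)) :
    Finset (Fin (n + 1) → ℕ) :=
  (mons (n + 1) d).filter fun u => (fun i => u (p.succAbove i)) ∈ N (u p)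

theorem ofLevs_subset {n : ℕ} (p : Fin (n + 1)) (d : ℕ) (N : ℕ → Finset (Fin n → ℕ)) :
    ofLevs p d N ⊆ mons (n + 1) d := filter_subset _ _

theorem lev_ofLevs {n d : ℕ} (p : Fin (n + 1)) {N : ℕ → Finset (Fin n → ℕ)} {j : ℕ} (hj : j ≤ d)
    (hN : N j ⊆ mons n (d - j)) : lev p j (ofLevs p d N) = N j := by
  ext v
  simp only [mem_lev, ofLevs, mem_filter, ins_mem_mons, ins_self, ins_succAbove]
  constructor
  · exact fun h => h.2
  · intro h
    have := mem_mons.1 (hN h)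
    exact ⟨by omega, h⟩

/-! ### Lexicographic segments -/

/-- `u` is lexicographically smaller than `w`, where the variable of largest index is the most
significant one. -/
def LexLT {n : ℕ} (u w : Fin n → ℕ) : Prop := ∃ p, u p < w p ∧ ∀ q, p < q → u q = w q

theorem LexLT.trichotomy {n : ℕ} (u w : Fin n → ℕ) : LexLT u w ∨ u = w ∨ LexLT w u := by
  by_cases h : u = w
  · exact Or.inr (Or.inl h)
  have hne : (univ.filter fun i => u i ≠ w i).Nonempty := by
    obtain ⟨i, hi⟩ := Function.ne_iff.1 h
    exact ⟨i, by simpa using hi⟩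
  obtain ⟨p, hp, hmax⟩ := exists_max_image _ id hne
  have hq : ∀ q, p < q → u q = w q := by
    intro q hq
    by_contra hc
    exact absurd (hmax q (by simpa using hc)) (not_le.2 hq)
  rcases lt_or_gt_of_ne (mem_filter.1 hp).2 with h1 | h1
  · exact Or.inl ⟨p, h1, hq⟩
  · exact Or.inr (Or.inr ⟨p, h1, fun q h => (hq q h).symm⟩)

theorem LexLT.asymm {n : ℕ} {u w : Fin n → ℕ} (h : LexLT u w) (h' : LexLT w u) : False := by
  obtain ⟨p, hp, hp'⟩ := h
  obtain ⟨q, hq, hq'⟩ := h'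
  rcases lt_trichotomy p q with hpq | rfl | hpq
  · have := hp' q hpq; omega
  · omega
  · have := hq' p hpq; omega

theorem LexLT.ne {n : ℕ} {u w : Fin n → ℕ} (h : LexLT u w) : u ≠ w := by
  rintro rfl
  exact h.asymm h

theorem LexLT.trans {n : ℕ} {u v w : Fin n → ℕ} (h : LexLT u v) (h' : LexLT v w) :
    LexLT u w := by
  obtain ⟨p, hp, hp'⟩ := h
  obtain ⟨q, hq, hq'⟩ := h'
  rcases lt_trichotomy p q with hpq | rfl | hpq
  · exact ⟨q, by rw [hp' q hpq]; exact hq, fun r hr => by rw [hp' r (hpq.trans hr), hq' r hr]⟩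
  · exact ⟨p, hp.trans hq, fun r hr => by rw [hp' r hr, hq' r hr]⟩
  · exact ⟨p, by rw [← hq' p hpq]; exact hp, fun r hr => by rw [hp' r hr, hq' r (hpq.trans hr)]⟩

theorem LexLT.ins_zero {n : ℕ} {v w : Fin n → ℕ} (h : LexLT v w) (j k : ℕ) :
    LexLT (ins 0 j v) (ins 0 k w) := by
  obtain ⟨p, hp, hp'⟩ := h
  refine ⟨p.succ, by simpa using hp, fun q hq => ?_⟩
  induction q using Fin.cases with
  | zero => simp at hq
  | succ q => simpa using hp' q (by simpa using hq)

theorem lexLT_ins_last {n : ℕ} {j k : ℕ} {v w : Fin n → ℕ} :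
    LexLT (ins (Fin.last n) j v) (ins (Fin.last n) k w) ↔ j < k ∨ j = k ∧ LexLT v w := by
  constructor
  · rintro ⟨p, hp, hp'⟩
    induction p using Fin.lastCases with
    | last => exact Or.inl (by simpa using hp)
    | cast p =>
      have h1 := hp' (Fin.last n) (Fin.castSucc_lt_last p)
      refine Or.inr ⟨by simpa using h1, p, by simpa using hp, fun q hq => ?_⟩
      simpa using hp' q.castSucc (by simpa using hq)
  · rintro (h | ⟨rfl, p, hp, hp'⟩)
    · exact ⟨Fin.last n, by simpa using h, fun q hq => absurd hq (not_lt.2 (Fin.le_last q))⟩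
    · refine ⟨p.castSucc, by simpa using hp, fun q hq => ?_⟩
      induction q using Fin.lastCases with
      | last => simp
      | cast q => simpa using hp' q (by simpa using hq)

/-- A lexicographic segment: a set of monomials of degree `d` closed under passing to
lexicographically larger monomials of degree `d`. -/
def IsSeg {n : ℕ} (d : ℕ) (L : Finset (Fin n → ℕ)) : Prop :=
  L ⊆ mons n d ∧ ∀ u ∈ L, ∀ w ∈ mons n d, LexLT u w → w ∈ L

theorem IsSeg.subset_or_subset {n d : ℕ} {L M : Finset (Fin n → ℕ)} (hL : IsSeg d L)
    (hM : IsSeg d M) : L ⊆ M ∨ M ⊆ L := by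
  by_contra! h
  obtain ⟨u, hu, hu'⟩ := not_subset.1 h.1
  obtain ⟨w, hw, hw'⟩ := not_subset.1 h.2
  rcases LexLT.trichotomy u w with h1 | rfl | h1
  · exact hw' (hL.2 u hu w (hM.1 hw) h1)
  · exact hu' hw
  · exact hu' (hM.2 w hw u (hL.1 hu) h1)

theorem IsSeg.subset_of_card_le {n d : ℕ} {L M : Finset (Fin n → ℕ)} (hL : IsSeg d L)
    (hM : IsSeg d M) (h : L.card ≤ M.card) : L ⊆ M := by
  rcases hL.subset_or_subset hM with h1 | h1
  · exact h1
  · exact (eq_of_subset_of_card_le h1 h).symm.subset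

/-- Adding the lexicographically largest missing monomial to a segment gives a segment again. -/
theorem exists_isSeg {n d k : ℕ} (hk : k ≤ (mons n d).card) :
    ∃ L : Finset (Fin n → ℕ), IsSeg d L ∧ L.card = k := by
  induction k with
  | zero => exact ⟨∅, ⟨empty_subset _, by simp⟩, rfl⟩
  | succ k ih =>
    obtain ⟨L, hL, hc⟩ := ih (by omega)
    have hne : (mons n d \ L).Nonempty := by
      rw [← card_pos, card_sdiff_of_subset hL.1]; omega
    obtain ⟨w, hw, hmax⟩ : ∃ w ∈ mons n d \ L, ∀ u ∈ mons n d \ L, ¬ LexLT w u := by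
      obtain ⟨w, hw⟩ := (mons n d \ L).exists_maximalFor (fun u => toColex u) hne
      refine ⟨w, hw.1, fun u hu hlt => ?_⟩
      obtain ⟨p, hp, hp'⟩ := hlt
      have : toColex w < toColex u := ⟨p, fun q hq => hp' q hq, hp⟩
      exact absurd (hw.2 hu this.le) (not_le.2 this)
    refine ⟨insert w L, ⟨insert_subset (mem_sdiff.1 hw).1 hL.1, fun u hu v hv huv => ?_⟩, ?_⟩
    · rcases mem_insert.1 hu with rfl | hu
      · by_contra hc
        exact hmax v (mem_sdiff.2 ⟨hv, fun h => hc (mem_insert_of_mem h)⟩) huv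
      · exact mem_insert_of_mem (hL.2 u hu v hv huv)
    · rw [card_insert_of_notMem (mem_sdiff.1 hw).2, hc]

/-- Let `w` lie above a product `a * x_i` with `a ∈ L`. Dividing `w` by its least significant
variable leaves a monomial `b` that is lexicographically at least `a`, so `b ∈ L`. -/
theorem IsSeg.up {n d : ℕ} {L : Finset (Fin n → ℕ)} (hL : IsSeg d L) : IsSeg (d + 1) (up L) := by
  refine ⟨up_subset_mons hL.1, fun u hu w hw huw => ?_⟩
  obtain ⟨a, ha, i, rfl⟩ := mem_up.1 hu
  obtain ⟨p, hp, hp'⟩ := huw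
  -- `m` is the least variable dividing `w`
  have hne : (univ.filter fun i => w i ≠ 0).Nonempty := by
    obtain ⟨i, hi⟩ := exists_ne_zero_of_mem_mons_succ hw
    exact ⟨i, by simpa using hi⟩
  obtain ⟨m, hm, hmin⟩ := exists_min_image _ id hne
  obtain ⟨b, rfl⟩ := exists_eq_add_single (mem_filter.1 hm).2
  have hb : b ∈ mons n d := add_single_mem_mons.1 hw
  suffices b ∈ L from add_single_mem_up this m
  have ha' := hL.1 ha
  simp only [Pi.add_apply, Pi.single_apply] at hp hp' hm hmin
  have hmp : m ≤ p := hmin p (by simp; split_ifs at hp ⊢ <;> omega)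
  rcases LexLT.trichotomy a b with h | rfl | h
  · exact hL.2 a ha b hb h
  · exact ha
  exfalso
  obtain ⟨q, hq, hq'⟩ := h
  -- above `p`, `b` dominates `a`, so `q ≤ p`
  have hqp : q ≤ p := by
    by_contra! hc
    have := hp' q hc
    rw [if_neg (hmp.trans_lt hc).ne'] at this
    omega
  have hip : i ≤ p := by
    by_contra! hc
    have h1 := hp' i hc
    rw [if_pos rfl, if_neg (hmp.trans_lt hc).ne'] at h1
    have := hq' i (hqp.trans_lt hc)
    omega
  have hmp' : m = p := by
    by_contra hne
    have hlt : m < p := lt_of_le_of_ne hmp hne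
    rw [if_neg hlt.ne'] at hp
    rcases hqp.lt_or_eq with h1 | rfl
    · have := hq' p h1; omega
    · omega
  subst hmp'
  have hlow : ∀ k < m, b k = 0 := by
    intro k hk
    by_contra hc
    exact absurd (hmin k (by simp [hc])) (not_le.2 hk)
  -- If `b` were below `a`, it would vanish below `q`, be smaller at `q` and agree with `a` above
  -- `q`, so its degree would be too small.
  have hsum : ∑ k, b k < ∑ k, a k := by
    refine sum_lt_sum (fun k _ => ?_) ⟨q, mem_univ _, hq⟩
    rcases lt_trichotomy k q with h1 | rfl | h1
    · rw [hlow k (h1.trans_le hqp)]; exact Nat.zero_le _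
    · exact hq.le
    · exact (hq' k h1).le
  rw [mem_mons.1 hb, mem_mons.1 ha'] at hsum
  exact lt_irrefl _ hsum

theorem IsSeg.lev_zero {n d : ℕ} {L : Finset (Fin (n + 1) → ℕ)} (hL : IsSeg d L) {j : ℕ}
    (hj : j ≤ d) : IsSeg (d - j) (lev 0 j L) := by
  refine ⟨lev_subset_mons hL.1 j, fun u hu w hw huw => ?_⟩
  rw [mem_lev] at hu ⊢
  refine hL.2 _ hu _ ?_ (huw.ins_zero j j)
  rw [ins_mem_mons, mem_mons.1 hw]; omega

/-! ### Stable sets -/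

/-- Stability with respect to replacing the variable `0` by any other variable. -/
def IsStable {n : ℕ} (V : Finset (Fin (n + 1) → ℕ)) : Prop :=
  ∀ j v i, ins 0 (j + 1) v ∈ V → ins 0 j (v + Pi.single i 1) ∈ V

theorem IsSeg.isStable {n d : ℕ} {L : Finset (Fin (n + 1) → ℕ)} (hL : IsSeg d L) :
    IsStable L := by
  intro j v i h
  refine hL.2 _ h _ ?_ ?_
  · have := ins_mem_mons.1 (hL.1 h)
    rw [ins_mem_mons, sum_add_single]; omega
  · refine LexLT.ins_zero ⟨i, by simp, fun q hq => by simp [hq.ne']⟩ _ _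

theorem IsStable.up_lev_subset {n : ℕ} {V : Finset (Fin (n + 1) → ℕ)} (hV : IsStable V) (j : ℕ) :
    up (lev 0 (j + 1) V) ⊆ lev 0 j V := by
  intro w hw
  obtain ⟨v, hv, i, rfl⟩ := mem_up.1 hw
  exact mem_lev.2 (hV j v i (mem_lev.1 hv))

/-- Stability puts the shadow of level `j + 1` inside level `j`, so the unions in `card_up_eq`
collapse to the levels of `V` themselves. -/
theorem IsStable.card_up {n d : ℕ} {V : Finset (Fin (n + 1) → ℕ)} (hV : IsStable V)
    (h : V ⊆ mons (n + 1) d) : (up V).card = V.card + (up (lev 0 0 V)).card := by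
  rw [card_up_eq 0 h, card_eq_sum_lev 0 h (lt_add_one d)]
  congr 1
  exact sum_congr rfl fun j _ => by rw [union_eq_left.2 (hV.up_lev_subset j)]

/-! ### Compression in two variables -/

/-- Initial segments are the only minimizers of the sum among sets of naturals of a given size. This
makes the total exponent at variable `0` a termination measure for compression. -/
theorem sum_range_card_le_sum (X : Finset ℕ) : ∑ x ∈ range X.card, x ≤ ∑ x ∈ X, x ∧
    (X ≠ range X.card → ∑ x ∈ range X.card, x < ∑ x ∈ X, x) := by
  set R := range X.card with hR
  have h1 := sum_inter_add_sum_sdiff X R (fun x => x)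
  have h2 := sum_inter_add_sum_sdiff R X (fun x => x)
  have hc : (X \ R).card = (R \ X).card := by
    have h3 := card_sdiff_add_card_inter X R
    have h4 := card_sdiff_add_card_inter R X
    rw [inter_comm R X, hR, card_range, ← hR] at h4
    omega
  have h3 : (X \ R).card * X.card ≤ ∑ x ∈ X \ R, x := by
    rw [← smul_eq_mul]
    refine card_nsmul_le_sum _ _ _ fun x hx => ?_
    simpa [hR] using (mem_sdiff.1 hx).2
  have h4 : ∑ x ∈ R \ X, x + (R \ X).card ≤ (R \ X).card * X.card := by
    rw [card_eq_sum_ones, ← sum_add_distrib, ← smul_eq_mul, ← card_eq_sum_ones]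
    refine sum_le_card_nsmul _ _ _ fun x hx => ?_
    have := (mem_sdiff.1 hx).1
    rw [hR, mem_range] at this
    omega
  rw [inter_comm R X] at h2
  rw [hc] at h3
  refine ⟨by omega, fun hne => ?_⟩
  have : 0 < (R \ X).card := by
    rw [card_pos, sdiff_nonempty]
    intro hs
    exact hne (eq_of_subset_of_card_le hs (by simp [hR])).symm
  omega

/-- The exponents of `u` at all variables but `0` and `i`. -/
def rest {n : ℕ} (i : Fin (n + 1)) (u : Fin (n + 1) → ℕ) : Fin (n + 1) → ℕ :=
  fun k => if k = 0 ∨ k = i then 0 else u k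

theorem rest_add {n : ℕ} (i : Fin (n + 1)) (u w : Fin (n + 1) → ℕ) :
    rest i (u + w) = rest i u + rest i w := by
  ext k; simp only [rest, Pi.add_apply]; split_ifs <;> rfl

theorem rest_single {n : ℕ} {i k : Fin (n + 1)} (h : k = 0 ∨ k = i) (a : ℕ) :
    rest i (Pi.single k a) = 0 := by
  ext m
  simp only [rest, Pi.single_apply, Pi.zero_apply]
  split_ifs <;> simp_all

theorem eq_of_rest_eq {n d : ℕ} {i : Fin (n + 1)} {u w : Fin (n + 1) → ℕ}
    (hu : u ∈ mons (n + 1) d) (hw : w ∈ mons (n + 1) d) (h : rest i u = rest i w)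
    (h0 : u 0 = w 0) : u = w := by
  have hk : ∀ k, k ≠ i → u k = w k := by
    intro k hk
    by_cases hk0 : k = 0
    · rw [hk0, h0]
    · have := congrFun h k
      simpa [rest, hk, hk0] using this
  ext k
  by_cases hki : k = i
  · subst hki
    rw [mem_mons, Fin.sum_univ_succAbove _ k] at hu hw
    have : ∑ m, u (k.succAbove m) = ∑ m, w (k.succAbove m) :=
      sum_congr rfl fun m _ => hk _ (Fin.succAbove_ne _ _)
    omega
  · exact hk k hki

/-- The number of members of `V` on the line through `u` in the direction of the variables `0`
and `i`. -/
def lineCard {n : ℕ} (i : Fin (n + 1)) (V : Finset (Fin (n + 1) → ℕ))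
    (r : Fin (n + 1) → ℕ) : ℕ := (V.filter fun w => rest i w = r).card

/-- Replace each line of `V` by the segment of the same size with the least exponents at `0`. -/
def compress {n : ℕ} (i : Fin (n + 1)) (d : ℕ) (V : Finset (Fin (n + 1) → ℕ)) :
    Finset (Fin (n + 1) → ℕ) :=
  (mons (n + 1) d).filter fun u => u 0 < lineCard i V (rest i u)

theorem injOn_line {n d : ℕ} {i : Fin (n + 1)} {V : Finset (Fin (n + 1) → ℕ)}
    (hV : V ⊆ mons (n + 1) d) (r : Fin (n + 1) → ℕ) :
    Set.InjOn (fun u : Fin (n + 1) → ℕ => u 0) (V.filter fun w => rest i w = r) := by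
  intro u hu w hw h
  simp only [coe_filter, Set.mem_ofPred_eq] at hu hw
  exact eq_of_rest_eq (hV hu.1) (hV hw.1) (hu.2.trans hw.2.symm) h

theorem image_line_compress {n d : ℕ} {i : Fin (n + 1)} (hi : i ≠ 0)
    {V : Finset (Fin (n + 1) → ℕ)} (hV : V ⊆ mons (n + 1) d) (r : Fin (n + 1) → ℕ) :
    ((compress i d V).filter fun w => rest i w = r).image (fun u => u 0) =
      range (lineCard i V r) := by
  ext t
  simp only [mem_image, mem_filter, compress, mem_range]
  constructor
  · rintro ⟨u, ⟨⟨-, h⟩, rfl⟩, rfl⟩; exact h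
  · intro ht
    obtain ⟨w, hw, hwr, htw⟩ : ∃ w ∈ V, rest i w = r ∧ t ≤ w 0 := by
      by_contra! hc
      have : (V.filter fun w => rest i w = r).image (fun u => u 0) ⊆ range t := by
        intro x hx
        obtain ⟨w, hw, rfl⟩ := mem_image.1 hx
        rw [mem_filter] at hw
        exact mem_range.2 (hc w hw.1 hw.2)
      have := card_le_card this
      rw [card_image_of_injOn (injOn_line hV r), card_range] at this
      exact absurd ht (not_lt.2 this)
    -- A line with more than `t` members has one whose exponent at `0` is at least `t`; its surplus
    -- is moved from variable `0` to variable `i`.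
    have hle : Pi.single 0 (w 0 - t) ≤ w + Pi.single i (w 0 - t) := by
      intro k
      by_cases hk : k = 0
      · subst hk; simp [hi.symm]
      · simp [hk]
    obtain ⟨u, hu⟩ := exists_add_of_le hle
    have hu0 : u 0 = t := by
      have := congrFun hu 0
      simp only [Pi.add_apply, Pi.single_eq_same, Pi.single_eq_of_ne hi.symm] at this
      omega
    have hur : rest i u = r := by
      have := congrArg (rest i) hu
      rw [rest_add, rest_add, rest_single (Or.inl rfl), rest_single (Or.inr rfl), add_zero,
        zero_add] at this
      rw [← this, hwr]
    have hum : u ∈ mons (n + 1) d := by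
      have h1 := congrArg (fun f => ∑ k, f k) hu
      simp only [Pi.add_apply, sum_add_distrib, sum_pi_single', mem_univ, if_true] at h1
      rw [mem_mons, ← mem_mons.1 (hV hw)]
      omega
    exact ⟨u, ⟨⟨hum, by rw [hur, hu0]; exact ht⟩, hur⟩, hu0⟩

theorem compress_subset {n : ℕ} (i : Fin (n + 1)) (d : ℕ) (V : Finset (Fin (n + 1) → ℕ)) :
    compress i d V ⊆ mons (n + 1) d := filter_subset _ _

theorem lineCard_compress {n d : ℕ} {i : Fin (n + 1)} (hi : i ≠ 0)
    {V : Finset (Fin (n + 1) → ℕ)} (hV : V ⊆ mons (n + 1) d) (r : Fin (n + 1) → ℕ) :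
    lineCard i (compress i d V) r = lineCard i V r := by
  rw [lineCard, ← card_image_of_injOn (injOn_line (compress_subset i d V) r),
    image_line_compress hi hV, card_range]

theorem card_compress {n d : ℕ} {i : Fin (n + 1)} (hi : i ≠ 0)
    {V : Finset (Fin (n + 1) → ℕ)} (hV : V ⊆ mons (n + 1) d) :
    (compress i d V).card = V.card := by
  rw [card_eq_sum_card_fiberwise (f := rest i) (t := (mons (n + 1) d).image (rest i))
      fun u hu => mem_image_of_mem _ (compress_subset _ _ _ hu),
    card_eq_sum_card_fiberwise (s := V) (f := rest i) (t := (mons (n + 1) d).image (rest i))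
      fun u hu => mem_image_of_mem _ (hV hu)]
  exact sum_congr rfl fun r _ => lineCard_compress hi hV r

theorem lineCard_le_lineCard_up {n : ℕ} (i k : Fin (n + 1)) (V : Finset (Fin (n + 1) → ℕ))
    (u : Fin (n + 1) → ℕ) :
    lineCard i V (rest i u) ≤ lineCard i (up V) (rest i (u + Pi.single k 1)) := by
  refine card_le_card_of_injOn (fun w => w + Pi.single k 1) (fun w hw => ?_) fun _ _ _ _ h =>
    add_right_cancel h
  simp only [coe_filter, Set.mem_ofPred_eq] at hw ⊢
  exact ⟨add_single_mem_up hw.1 k, by rw [rest_add, rest_add, hw.2]⟩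

/-- Multiplication by variable `i` keeps a line and its exponents at `0`; multiplying the member
with the largest such exponent by variable `0` gives one point more. -/
theorem lineCard_lt_lineCard_up {n : ℕ} {i : Fin (n + 1)} (hi : i ≠ 0)
    {V : Finset (Fin (n + 1) → ℕ)} {r : Fin (n + 1) → ℕ} (h : 0 < lineCard i V r) :
    lineCard i V r < lineCard i (up V) r := by
  obtain ⟨w, hw, hmax⟩ := exists_max_image _ (fun w => w 0) (card_pos.1 h)
  have hsub : insert (w + Pi.single 0 1)
      ((V.filter fun w => rest i w = r).image fun v => v + Pi.single i 1) ⊆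
      (up V).filter fun w => rest i w = r := by
    rw [mem_filter] at hw
    refine insert_subset ?_ fun x hx => ?_
    · rw [mem_filter]
      exact ⟨add_single_mem_up hw.1 0, by rw [rest_add, rest_single (Or.inl rfl), hw.2, add_zero]⟩
    · obtain ⟨v, hv, rfl⟩ := mem_image.1 hx
      rw [mem_filter] at hv ⊢
      exact ⟨add_single_mem_up hv.1 i, by rw [rest_add, rest_single (Or.inr rfl), hv.2, add_zero]⟩
  have := card_le_card hsub
  rw [card_insert_of_notMem, card_image_of_injective _ (add_left_injective _)] at this
  · exact this
  · intro hx
    obtain ⟨v, hv, he⟩ := mem_image.1 hx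
    have h1 := hmax v hv
    have h2 := congrFun he 0
    simp only [Pi.add_apply, Pi.single_eq_same, Pi.single_eq_of_ne hi.symm] at h2
    omega

/-- Compressed lines are initial segments, so the inclusion only compares lengths. Multiplying by
variable `0` raises the exponent by one, but the line has also grown by at least one. -/
theorem up_compress_subset {n d : ℕ} {i : Fin (n + 1)} (hi : i ≠ 0)
    (V : Finset (Fin (n + 1) → ℕ)) : up (compress i d V) ⊆ compress i (d + 1) (up V) := by
  intro w hw
  obtain ⟨u, hu, k, rfl⟩ := mem_up.1 hw
  rw [compress, mem_filter] at hu ⊢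
  refine ⟨add_single_mem_mons.2 hu.1, ?_⟩
  by_cases hk : k = 0
  · subst hk
    have h1 := lineCard_lt_lineCard_up hi (r := rest i u) (V := V) (by omega)
    rw [rest_add, rest_single (Or.inl rfl), add_zero]
    simp only [Pi.add_apply, Pi.single_eq_same]
    omega
  · have h1 := lineCard_le_lineCard_up i k V u
    simp only [Pi.add_apply, Pi.single_eq_of_ne (Ne.symm hk), add_zero]
    omega

theorem card_up_compress_le {n d : ℕ} {i : Fin (n + 1)} (hi : i ≠ 0)
    {V : Finset (Fin (n + 1) → ℕ)} (hV : V ⊆ mons (n + 1) d) :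
    (up (compress i d V)).card ≤ (up V).card :=
  (card_le_card (up_compress_subset hi V)).trans_eq (card_compress hi (up_subset_mons hV))

theorem sum_compress {n d : ℕ} {i : Fin (n + 1)} (hi : i ≠ 0)
    {V : Finset (Fin (n + 1) → ℕ)} (hV : V ⊆ mons (n + 1) d) {r : Fin (n + 1) → ℕ}
    (hr : r ∈ (mons (n + 1) d).image (rest i))
    (hne : (V.filter fun w => rest i w = r).image (fun u => u 0) ≠ range (lineCard i V r)) :
    ∑ u ∈ compress i d V, u 0 < ∑ u ∈ V, u 0 := by
  rw [← sum_fiberwise_of_maps_to (g := rest i) (t := (mons (n + 1) d).image (rest i))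
      fun u hu => mem_image_of_mem _ (compress_subset _ _ _ hu),
    ← sum_fiberwise_of_maps_to (s := V) (g := rest i) (t := (mons (n + 1) d).image (rest i))
      fun u hu => mem_image_of_mem _ (hV hu)]
  have key : ∀ s, ∑ u ∈ compress i d V with rest i u = s, u 0 =
      ∑ x ∈ range (lineCard i V s), x := fun s => by
    rw [← image_line_compress hi hV,
      sum_image (injOn_line (compress_subset i d V) s)]
  have key' : ∀ s, ∑ u ∈ V with rest i u = s, u 0 =
      ∑ x ∈ (V.filter fun w => rest i w = s).image (fun u => u 0), x := fun s => by
    rw [sum_image (injOn_line hV s)]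
  have hc : ∀ s, lineCard i V s =
      ((V.filter fun w => rest i w = s).image (fun u => u 0)).card := fun s => by
    rw [card_image_of_injOn (injOn_line hV s), lineCard]
  simp_rw [key, key']
  refine sum_lt_sum (fun s _ => ?_) ⟨r, hr, ?_⟩
  · rw [hc]; exact (sum_range_card_le_sum _).1
  · rw [hc] at hne ⊢; exact (sum_range_card_le_sum _).2 hne

/-- If stability fails for the variable `i.succ`, compression in that direction strictly lowers the
total exponent at variable `0`, keeps the size and does not enlarge the shadow. Iterating must end
at a stable set. -/
theorem exists_isStable {n d : ℕ} {V : Finset (Fin (n + 1) → ℕ)} (hV : V ⊆ mons (n + 1) d) :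
    ∃ W ⊆ mons (n + 1) d, W.card = V.card ∧ (up W).card ≤ (up V).card ∧ IsStable W := by
  induction h : ∑ u ∈ V, u 0 using Nat.strong_induction_on generalizing V with
  | _ N ih =>
    subst h
    by_cases hs : IsStable V
    · exact ⟨V, hV, rfl, le_rfl, hs⟩
    simp only [IsStable, not_forall] at hs
    obtain ⟨j, v, i, hin, hout⟩ := hs
    have hi : i.succ ≠ 0 := Fin.succ_ne_zero i
    have hlt : ∑ u ∈ compress i.succ d V, u 0 < ∑ u ∈ V, u 0 := by
      refine sum_compress hi hV (mem_image_of_mem _ (hV hin)) fun heq => hout ?_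
      have h1 : j + 1 ∈ range (lineCard i.succ V (rest i.succ (ins 0 (j + 1) v))) := by
        rw [← heq]
        exact mem_image.2 ⟨_, mem_filter.2 ⟨hin, rfl⟩, ins_self _ _ _⟩
      have h2 : j ∈ range (lineCard i.succ V (rest i.succ (ins 0 (j + 1) v))) :=
        mem_range.2 ((Nat.lt_succ_self j).trans (mem_range.1 h1))
      rw [← heq] at h2
      obtain ⟨w, hw, hw0⟩ := mem_image.1 h2
      rw [mem_filter] at hw
      convert hw.1
      refine eq_of_rest_eq (d := d) (i := i.succ) ?_ (hV hw.1) ?_ (by simp [hw0])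
      · have := ins_mem_mons.1 (hV hin)
        rw [ins_mem_mons, sum_add_single]; omega
      · rw [hw.2]
        ext k
        simp only [rest]
        split_ifs with hk
        · rfl
        · obtain ⟨m, rfl⟩ := Fin.exists_succ_eq.2 (fun h => hk (Or.inl h))
          have : m ≠ i := fun h => hk (Or.inr (by rw [h]))
          simp [this]
    obtain ⟨W, h1, h2, h3, h4⟩ := ih _ hlt (compress_subset _ _ _) rfl
    exact ⟨W, h1, h2.trans (card_compress hi hV), h3.trans (card_up_compress_le hi hV), h4⟩

/-! ### Macaulay's theorem -/

/-- Climbs from level `j` to level `0` by multiplying `j` times by the least significant remaining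
variable. -/
theorem add_single_mem_of_up_subset {n : ℕ} {N : ℕ → Finset (Fin (n + 1) → ℕ)} {d : ℕ}
    (hN : ∀ j < d, up (N (j + 1)) ⊆ N j) {j : ℕ} (hj : j ≤ d) {u : Fin (n + 1) → ℕ}
    (hu : u ∈ N j) : u + Pi.single 0 j ∈ N 0 := by
  induction j generalizing u with
  | zero => simpa using hu
  | succ j ih =>
    have := ih (by omega) (hN j (by omega) (add_single_mem_up hu 0))
    rwa [add_assoc, ← Pi.single_add, add_comm 1 j] at this

/-- Macaulay's theorem: lexicographic segments have the smallest upper shadow. -/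
theorem macaulay {n d : ℕ} {L V : Finset (Fin n → ℕ)} (hL : IsSeg d L) (hV : V ⊆ mons n d)
    (h : L.card ≤ V.card) : (up L).card ≤ (up V).card := by
  induction n generalizing d with
  | zero =>
    rcases (up L).eq_empty_or_nonempty with h1 | ⟨w, hw⟩
    · simp [h1]
    · obtain ⟨_, _, i, _⟩ := mem_up.1 hw; exact i.elim0
  | succ n ih =>
    obtain ⟨V', hV', hc, hup, hst⟩ := exists_isStable hV
    rw [← hc] at h
    refine le_trans ?_ hup
    clear hup hc hV V
    rw [hst.card_up hV', hL.isStable.card_up hL.1]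
    -- By stability it suffices to compare level zero. If `L` had the larger one, every lex-ordered
    -- level `N j` of `V'` would lie in the matching level of `L`, making `L` larger than `V'`.
    refine add_le_add h (ih (by simpa using hL.lev_zero (Nat.zero_le d))
      (lev_subset_mons hV' 0) ?_)
    by_contra! hlt
    have hex : ∀ j, ∃ N : Finset (Fin n → ℕ), IsSeg (d - j) N ∧ N.card = (lev 0 j V').card :=
      fun j => exists_isSeg (card_le_card (lev_subset_mons hV' j))
    choose N hN hNc using hex
    have hNup : ∀ j < d, up (N (j + 1)) ⊆ N j := by
      intro j hj
      have hs : d - j = d - (j + 1) + 1 := by omega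
      refine IsSeg.subset_of_card_le (hN (j + 1)).up (hs ▸ hN j) ?_
      calc (up (N (j + 1))).card ≤ (up (lev 0 (j + 1) V')).card :=
            ih (hN _) (lev_subset_mons hV' _) (hNc _).le
        _ ≤ (lev 0 j V').card := card_le_card (hst.up_lev_subset j)
        _ = (N j).card := (hNc j).symm
    obtain ⟨w, hwL, hwN⟩ := exists_mem_notMem_of_card_lt_card
      (by rwa [hNc 0] : (N 0).card < (lev 0 0 L).card)
    have hsub : ∀ j ≤ d, N j ⊆ lev 0 j L := by
      intro j hj u hu
      -- With a single original variable there is no remaining variable to climb with, but then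
      -- every `N j` is empty.
      rcases n with _ | n
      · exfalso
        have h0 : N 0 = ∅ := by
          by_contra hne
          obtain ⟨x, hx⟩ := nonempty_iff_ne_empty.2 hne
          exact hwN ((Subsingleton.elim x w) ▸ hx)
        have hall : ∀ k ≤ d, k ≠ d → N k = ∅ := by
          intro k hk hkd
          refine eq_empty_of_forall_notMem fun x hx => ?_
          have := mem_mons.1 ((hN k).1 hx)
          simp at this; omega
        have hd : d = 0 := by
          have := ins_mem_mons.1 (hL.1 (mem_lev.1 hwL))
          simpa using this.symm
        subst hd
        obtain rfl : j = 0 := by omega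
        simp [h0] at hu
      have hu0 := add_single_mem_of_up_subset hNup hj hu
      have hw := mem_lev.1 hwL
      have hwd := mem_mons.1 (lev_subset_mons hL.1 0 hwL)
      have hud := mem_mons.1 ((hN j).1 hu)
      have hud0 := mem_mons.1 ((hN 0).1 hu0)
      rcases LexLT.trichotomy w (u + Pi.single 0 j) with h1 | h1 | h1
      · rw [mem_lev]
        refine hL.2 _ hw _ (by rw [ins_mem_mons, hud]; omega) (LexLT.ins_zero ?_ _ _)
        -- Both monomials have degree `d`, so they cannot differ at position `0` alone. The deciding
        -- position is therefore one where the added power of variable `0` is invisible.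
        obtain ⟨p, hp, hp'⟩ := h1
        have hq : ∀ q, p < q → w q = u q := fun q hq => by
          have := hp' q hq
          rwa [Pi.add_apply, Pi.single_eq_of_ne ((Fin.zero_le p).trans_lt hq).ne', add_zero] at this
        by_cases hp0 : p = 0
        · exfalso
          subst hp0
          rw [Fin.sum_univ_succ] at hwd hud0
          have : ∑ i : Fin n, w i.succ = ∑ i : Fin n, (u + Pi.single 0 j : Fin (n + 1) → ℕ) i.succ :=
            sum_congr rfl fun i _ => hp' _ (Fin.succ_pos i)
          omega
        · refine ⟨p, ?_, hq⟩
          rwa [Pi.add_apply, Pi.single_eq_of_ne hp0, add_zero] at hp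
      · exact absurd (h1 ▸ hu0) hwN
      · refine absurd ((hN 0).2 _ hu0 w ?_ h1) hwN
        simpa [mem_mons] using hwd
    have hlast : V'.card < L.card := by
      rw [card_eq_sum_lev 0 hV' (lt_add_one d), card_eq_sum_lev 0 hL.1 (lt_add_one d)]
      refine sum_lt_sum (fun j hj => ?_) ⟨0, by simp, hlt⟩
      rw [← hNc]
      exact card_le_card (hsub j (by simpa [Nat.lt_add_one_iff] using hj))
    omega

/-! ### Sets of monomials with the smallest possible upper shadow -/

/-- `A` is a set of monomials of degree `d` whose upper shadow is as small as possible. -/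
def Opt {n : ℕ} (d : ℕ) (A : Finset (Fin n → ℕ)) : Prop :=
  A ⊆ mons n d ∧ ∀ B ⊆ mons n d, B.card = A.card → (up A).card ≤ (up B).card

theorem opt_iff {n d : ℕ} {A L : Finset (Fin n → ℕ)} (hA : A ⊆ mons n d) (hL : IsSeg d L)
    (h : L.card = A.card) : Opt d A ↔ (up A).card ≤ (up L).card :=
  ⟨fun hA => hA.2 L hL.1 h,
    fun h' => ⟨hA, fun _ hB hc => h'.trans (macaulay hL hB (h.trans hc.symm).le)⟩⟩

theorem opt_empty {n : ℕ} (d : ℕ) : Opt d (∅ : Finset (Fin n → ℕ)) := by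
  refine ⟨empty_subset _, fun _ _ _ => by simp⟩

theorem exists_isSeg_card {n d : ℕ} {A : Finset (Fin n → ℕ)} (hA : A ⊆ mons n d) :
    ∃ L : Finset (Fin n → ℕ), IsSeg d L ∧ L.card = A.card := exists_isSeg (card_le_card hA)

/-- The levels of an optimal set. -/
theorem Opt.lev {n d : ℕ} {A : Finset (Fin (n + 1) → ℕ)} (hA : Opt d A) (p : Fin (n + 1)) :
    Opt d (lev p 0 A) ∧ ∀ j < d,
      up (lev p (j + 1) A) ⊆ lev p j A ∨ Opt (d - (j + 1)) (lev p (j + 1) A) := by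
  have hsub := lev_subset_mons (p := p) hA.1
  choose N hN hNc using fun j => exists_isSeg_card (hsub j)
  -- All levels are replaced by segments of the same sizes. Segments of one degree are nested, so
  -- each union becomes a maximum of cardinalities, which is a lower bound for the corresponding
  -- union of `A`.
  set B := ofLevs p d N with hB
  have hBs : B ⊆ mons (n + 1) d := ofLevs_subset _ _ _
  have hlev : ∀ j, SqfGotzmann.lev p j B = N j := by
    intro j
    rcases le_or_gt j d with hj | hj
    · exact lev_ofLevs p hj (hN j).1
    · rw [lev_eq_empty hBs hj, eq_comm, ← card_eq_zero, hNc, lev_eq_empty hA.1 hj, card_empty]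
  have hBc : B.card = A.card := by
    rw [card_eq_sum_lev p hBs (lt_add_one d), card_eq_sum_lev p hA.1 (lt_add_one d)]
    exact sum_congr rfl fun j _ => by rw [hlev, hNc]
  have hmac : ∀ j, (up (N j)).card ≤ (up (SqfGotzmann.lev p j A)).card :=
    fun j => macaulay (hN j) (hsub j) (hNc j).le
  have hterm : ∀ j ≤ d, (N j ∪ up (N (j + 1))).card ≤
      max (SqfGotzmann.lev p j A).card (up (N (j + 1))).card := by
    intro j hj
    rcases hj.lt_or_eq with hj | rfl
    · have hs : d - j = d - (j + 1) + 1 := by omega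
      rcases (hN j).subset_or_subset (hs ▸ (hN (j + 1)).up) with h | h
      · rw [union_eq_right.2 h]; exact le_max_right _ _
      · rw [union_eq_left.2 h, hNc]; exact le_max_left _ _
    · have : N (j + 1) = ∅ := by
        rw [← card_eq_zero, hNc, lev_eq_empty hA.1 (lt_add_one j), card_empty]
      rw [this, up_empty, union_empty, hNc]; exact le_max_left _ _
  have hterm' : ∀ j, max (SqfGotzmann.lev p j A).card (up (N (j + 1))).card ≤
      (SqfGotzmann.lev p j A ∪ up (SqfGotzmann.lev p (j + 1) A)).card := fun j =>
    max_le (card_le_card subset_union_left) ((hmac _).trans (card_le_card subset_union_right))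
  have hle := hA.2 B hBs hBc
  rw [card_up_eq p hA.1, card_up_eq p hBs] at hle
  simp_rw [hlev] at hle
  have hs1 : ∀ j ∈ range (d + 1), (N j ∪ up (N (j + 1))).card ≤
      (SqfGotzmann.lev p j A ∪ up (SqfGotzmann.lev p (j + 1) A)).card := fun j hj =>
    (hterm j (by simpa [Nat.lt_add_one_iff] using hj)).trans (hterm' j)
  have hsum := sum_le_sum hs1
  have h0 := hmac 0
  refine ⟨(opt_iff (by simpa using hsub 0) (by simpa using hN 0) (hNc 0)).2 (by omega), ?_⟩
  intro j hj
  -- Optimality of `A` forces equality in every summand; which entry attains the maximum decides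
  -- between the two alternatives.
  have heq := (sum_eq_sum_iff_of_le hs1).1 (by omega) j (by simp; omega)
  have hj' := heq ▸ hterm j hj.le
  rcases le_max_iff.1 hj' with h | h
  · left
    have := eq_of_subset_of_card_le subset_union_left h
    exact union_eq_left.1 this.symm
  · right
    exact (opt_iff (hsub _) (hN _) (hNc _)).2 ((card_le_card subset_union_right).trans h)

/-! ### Operations preserving optimality -/

/-- The monomials of degree `d` that are divisible by the variable `p` or lie in `A`. -/
def adj {n : ℕ} (p : Fin (n + 1)) (d : ℕ) (A : Finset (Fin n → ℕ)) :
    Finset (Fin (n + 1) → ℕ) :=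
  ofLevs p d fun j => if j = 0 then A else mons n (d - j)

theorem ins_mem_adj {n d : ℕ} {p : Fin (n + 1)} {A : Finset (Fin n → ℕ)}
    {j : ℕ} {v : Fin n → ℕ} :
    ins p j v ∈ adj p d A ↔ j + ∑ i, v i = d ∧ (j = 0 → v ∈ A) := by
  simp only [adj, ofLevs, mem_filter, ins_mem_mons, ins_self, ins_succAbove]
  refine and_congr_right fun h => ?_
  by_cases hj : j = 0
  · simp [hj]
  · simp only [hj, if_false, mem_mons, false_imp_iff, iff_true]; omega

theorem lev_adj {n d : ℕ} (p : Fin (n + 1)) {A : Finset (Fin n → ℕ)} (hA : A ⊆ mons n d)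
    {j : ℕ} (hj : j ≤ d) : lev p j (adj p d A) = if j = 0 then A else mons n (d - j) := by
  refine lev_ofLevs p hj ?_
  split_ifs with h
  · simpa [h] using hA
  · exact subset_rfl

theorem adj_subset {n : ℕ} (p : Fin (n + 1)) (d : ℕ) (A : Finset (Fin n → ℕ)) :
    adj p d A ⊆ mons (n + 1) d := ofLevs_subset _ _ _

theorem card_adj {n d : ℕ} (p q : Fin (n + 1)) {A B : Finset (Fin n → ℕ)} (hA : A ⊆ mons n d)
    (hB : B ⊆ mons n d) (h : A.card = B.card) : (adj p d A).card = (adj q d B).card := by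
  rw [card_eq_sum_lev p (adj_subset _ _ _) (lt_add_one d),
    card_eq_sum_lev q (adj_subset _ _ _) (lt_add_one d)]
  refine sum_congr rfl fun j hj => ?_
  rw [mem_range, Nat.lt_add_one_iff] at hj
  rw [lev_adj p hA hj, lev_adj q hB hj]
  split_ifs
  · exact h
  · rfl

/-- In `card_up_eq` every term except the shadow of level zero depends only on the size of `A`: for
`d > 0` the term at `j = 0` is already everything. -/
theorem card_up_adj {n d : ℕ} (p q : Fin (n + 1)) {A B : Finset (Fin n → ℕ)}
    (hA : A ⊆ mons n d) (hB : B ⊆ mons n d) (h : A.card = B.card) :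
    (up (adj p d A)).card + (up B).card = (up (adj q d B)).card + (up A).card := by
  rw [card_up_eq p (adj_subset _ _ _), card_up_eq q (adj_subset _ _ _),
    lev_adj p hA (Nat.zero_le d), lev_adj q hB (Nat.zero_le d), if_pos rfl, if_pos rfl]
  have : ∀ j ∈ range (d + 1), (lev p j (adj p d A) ∪ up (lev p (j + 1) (adj p d A))).card =
      (lev q j (adj q d B) ∪ up (lev q (j + 1) (adj q d B))).card := by
    intro j hj
    rw [mem_range, Nat.lt_add_one_iff] at hj
    rw [lev_adj p hA hj, lev_adj q hB hj]
    rcases hj.lt_or_eq with hj | rfl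
    · rw [lev_adj p hA hj, lev_adj q hB hj, if_neg (Nat.succ_ne_zero j),
        if_neg (Nat.succ_ne_zero j), up_mons]
      split_ifs with h0
      · subst h0
        have hd : d - (0 + 1) + 1 = d := by omega
        rw [hd, union_eq_right.2 hA, union_eq_right.2 hB]
      · rfl
    · rw [lev_eq_empty (adj_subset _ _ _) (lt_add_one j),
        lev_eq_empty (adj_subset _ _ _) (lt_add_one j), up_empty]
      simp only [union_empty]
      split_ifs
      · exact h
      · rfl
  rw [sum_congr rfl this]
  omega

/-- The last variable is the most significant, so its multiples precede all other monomials. -/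
theorem IsSeg.adj {n d : ℕ} {L : Finset (Fin n → ℕ)} (hL : IsSeg d L) :
    IsSeg d (adj (Fin.last n) d L) := by
  refine ⟨adj_subset _ _ _, fun u hu w hw huw => ?_⟩
  rw [eq_ins (Fin.last n) u] at hu huw
  rw [eq_ins (Fin.last n) w] at hw huw ⊢
  rw [ins_mem_adj] at hu ⊢
  rw [lexLT_ins_last] at huw
  refine ⟨ins_mem_mons.1 hw, fun h0 => ?_⟩
  rw [h0] at huw hw
  rcases huw with h | ⟨h, h'⟩
  · exact absurd h (Nat.not_lt_zero _)
  · refine hL.2 _ (hu.2 h) _ ?_ h'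
    have := ins_mem_mons.1 hw
    rw [mem_mons]; omega

theorem opt_adj_iff {n d : ℕ} (p : Fin (n + 1)) {A : Finset (Fin n → ℕ)} (hA : A ⊆ mons n d) :
    Opt d (adj p d A) ↔ Opt d A := by
  obtain ⟨L, hL, hc⟩ := exists_isSeg_card hA
  rw [opt_iff hA hL hc, opt_iff (adj_subset _ _ _) hL.adj (card_adj _ _ hL.1 hA hc)]
  have := card_up_adj p (Fin.last n) hA hL.1 hc.symm
  omega

/-- All products of the variable `i` with a member of `A`. -/
def mulVar {n : ℕ} (i : Fin n) (A : Finset (Fin n → ℕ)) : Finset (Fin n → ℕ) :=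
  A.image fun u => u + Pi.single i 1

theorem card_mulVar {n : ℕ} (i : Fin n) (A : Finset (Fin n → ℕ)) :
    (mulVar i A).card = A.card := card_image_of_injective _ (add_left_injective _)

theorem up_mulVar {n : ℕ} (i : Fin n) (A : Finset (Fin n → ℕ)) :
    up (mulVar i A) = mulVar i (up A) := by
  ext w
  simp only [mem_up, mulVar, mem_image]
  constructor
  · rintro ⟨_, ⟨u, hu, rfl⟩, k, rfl⟩
    exact ⟨_, ⟨u, hu, k, rfl⟩, add_right_comm _ _ _⟩
  · rintro ⟨_, ⟨u, hu, k, rfl⟩, rfl⟩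
    exact ⟨_, ⟨u, hu, rfl⟩, k, add_right_comm _ _ _⟩

theorem mulVar_subset {n d : ℕ} {i : Fin n} {A : Finset (Fin n → ℕ)} (hA : A ⊆ mons n d) :
    mulVar i A ⊆ mons n (d + 1) := by
  intro w hw
  obtain ⟨u, hu, rfl⟩ := mem_image.1 hw
  exact add_single_mem_mons.2 (hA hu)

theorem LexLT.of_add {n : ℕ} {u w c : Fin n → ℕ} (h : LexLT (u + c) (w + c)) : LexLT u w := by
  obtain ⟨p, hp, hp'⟩ := h
  exact ⟨p, by simpa using hp, fun q hq => by simpa using hp' q hq⟩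

theorem IsSeg.mulVar_last {n d : ℕ} {L : Finset (Fin (n + 1) → ℕ)} (hL : IsSeg d L) :
    IsSeg (d + 1) (mulVar (Fin.last n) L) := by
  refine ⟨mulVar_subset hL.1, fun u hu w hw huw => ?_⟩
  obtain ⟨a, ha, rfl⟩ := mem_image.1 hu
  have hw0 : w (Fin.last n) ≠ 0 := by
    obtain ⟨p, hp, hp'⟩ := huw
    rcases (Fin.le_last p).lt_or_eq with h | rfl
    · have := hp' _ h
      simp at this; omega
    · omega
  obtain ⟨b, rfl⟩ := exists_eq_add_single hw0
  exact mem_image_of_mem _ (hL.2 a ha b (add_single_mem_mons.1 hw) huw.of_add)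

theorem Opt.mulVar {n d : ℕ} {A : Finset (Fin n → ℕ)} (hA : Opt d A) (i : Fin n) :
    Opt (d + 1) (mulVar i A) := by
  rcases n with _ | n
  · exact i.elim0
  obtain ⟨L, hL, hc⟩ := exists_isSeg_card hA.1
  rw [opt_iff (mulVar_subset hA.1) hL.mulVar_last (by rw [card_mulVar, card_mulVar, hc]),
    up_mulVar, up_mulVar, card_mulVar, card_mulVar]
  exact (opt_iff hA.1 hL hc).1 hA

/-- Rename the variables of the members of `A`. -/
def renameVars {n : ℕ} (σ : Equiv.Perm (Fin n)) (A : Finset (Fin n → ℕ)) :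
    Finset (Fin n → ℕ) := A.image fun u => u ∘ σ

theorem mem_renameVars {n : ℕ} {σ : Equiv.Perm (Fin n)} {A : Finset (Fin n → ℕ)}
    {w : Fin n → ℕ} : w ∈ renameVars σ A ↔ w ∘ σ.symm ∈ A := by
  rw [renameVars, mem_image]
  constructor
  · rintro ⟨u, hu, rfl⟩
    simpa [Function.comp_assoc] using hu
  · exact fun h => ⟨_, h, by simp [Function.comp_assoc]⟩

theorem card_renameVars {n : ℕ} (σ : Equiv.Perm (Fin n)) (A : Finset (Fin n → ℕ)) :
    (renameVars σ A).card = A.card :=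
  card_image_of_injective _ σ.surjective.injective_comp_right

theorem single_comp_perm {n : ℕ} (σ : Equiv.Perm (Fin n)) (i : Fin n) :
    (Pi.single i 1 : Fin n → ℕ) ∘ σ = Pi.single (σ.symm i) 1 := by
  ext k
  simp only [Function.comp_apply, Pi.single_apply, Equiv.eq_symm_apply]

theorem up_renameVars {n : ℕ} (σ : Equiv.Perm (Fin n)) (A : Finset (Fin n → ℕ)) :
    up (renameVars σ A) = renameVars σ (up A) := by
  ext w
  rw [mem_renameVars, mem_up, mem_up]
  constructor
  · rintro ⟨u, hu, i, rfl⟩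
    refine ⟨_, mem_renameVars.1 hu, σ i, ?_⟩
    rw [Pi.add_comp, single_comp_perm, Equiv.symm_symm]
  · rintro ⟨u, hu, i, h⟩
    refine ⟨u ∘ σ, mem_image_of_mem _ hu, σ.symm i, ?_⟩
    rw [← single_comp_perm, ← Pi.add_comp, ← h, Function.comp_assoc, Equiv.symm_comp_self,
      Function.comp_id]

theorem renameVars_subset {n d : ℕ} {σ : Equiv.Perm (Fin n)} {A : Finset (Fin n → ℕ)}
    (hA : A ⊆ mons n d) : renameVars σ A ⊆ mons n d := by
  intro w hw
  have := mem_mons.1 (hA (mem_renameVars.1 hw))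
  rw [mem_mons, ← this]
  exact (Equiv.sum_comp σ.symm w).symm

theorem Opt.renameVars {n d : ℕ} {A : Finset (Fin n → ℕ)} (hA : Opt d A)
    (σ : Equiv.Perm (Fin n)) : Opt d (renameVars σ A) := by
  refine ⟨renameVars_subset hA.1, fun B hB h => ?_⟩
  rw [up_renameVars, card_renameVars]
  rw [card_renameVars] at h
  exact hA.2 B hB h

/-! ### Squarefree families -/

/-- The support of an exponent vector. -/
def supp {n : ℕ} (u : Fin n → ℕ) : Finset (Fin n) := univ.filter fun i => u i ≠ 0

@[simp] theorem mem_supp {n : ℕ} {u : Fin n → ℕ} {i : Fin n} : i ∈ supp u ↔ u i ≠ 0 := by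
  simp [supp]

open Classical in
/-- The monomials of degree `d` whose support belongs to `F`. -/
noncomputable def cmp {n : ℕ} (F : Finset (Fin n) → Prop) (d : ℕ) : Finset (Fin n → ℕ) :=
  (mons n d).filter fun u => F (supp u)

theorem mem_cmp {n : ℕ} {F : Finset (Fin n) → Prop} {d : ℕ} {u : Fin n → ℕ} :
    u ∈ cmp F d ↔ ∑ i, u i = d ∧ F (supp u) := by
  simp [cmp, mem_mons]

theorem cmp_subset {n : ℕ} (F : Finset (Fin n) → Prop) (d : ℕ) : cmp F d ⊆ mons n d := by
  classical exact filter_subset _ _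

/-- The squarefree ideal with the family `F` is Gotzmann. -/
def Gotz {n : ℕ} (F : Finset (Fin n) → Prop) : Prop := ∀ d, Opt d (cmp F d)

/-- The family obtained from `F` by setting the variable `p` to zero. -/
def del {n : ℕ} (p : Fin (n + 1)) (F : Finset (Fin (n + 1)) → Prop) : Finset (Fin n) → Prop :=
  fun s => F (s.map p.succAboveEmb)

/-- The family obtained from `F` by setting the variable `p` to one. -/
def lk {n : ℕ} (p : Fin (n + 1)) (F : Finset (Fin (n + 1)) → Prop) : Finset (Fin n) → Prop :=
  fun s => F (insert p (s.map p.succAboveEmb))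

theorem del_mono {n : ℕ} {F : Finset (Fin (n + 1)) → Prop} (hF : Monotone F)
    (p : Fin (n + 1)) : Monotone (del p F) :=
  fun _ _ h => hF (map_subset_map.2 h)

theorem lk_mono {n : ℕ} {F : Finset (Fin (n + 1)) → Prop} (hF : Monotone F)
    (p : Fin (n + 1)) : Monotone (lk p F) :=
  fun _ _ h => hF (insert_subset_insert _ (map_subset_map.2 h))

theorem del_le_lk {n : ℕ} {F : Finset (Fin (n + 1)) → Prop} (hF : Monotone F)
    (p : Fin (n + 1)) {s : Finset (Fin n)} (h : del p F s) : lk p F s :=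
  hF (subset_insert _ _) h

theorem eq_map_or_eq_insert {n : ℕ} (p : Fin (n + 1)) (s : Finset (Fin (n + 1))) :
    (p ∉ s ∧ ∃ t : Finset (Fin n), s = t.map p.succAboveEmb) ∨
      (p ∈ s ∧ ∃ t : Finset (Fin n), s = insert p (t.map p.succAboveEmb)) := by
  have key : ∀ i, i ≠ p → (i ∈ s ↔ i ∈ (univ.filter fun i => p.succAbove i ∈ s).map
      p.succAboveEmb) := by
    intro i hi
    obtain ⟨k, rfl⟩ := Fin.exists_succAbove_eq hi
    simp
  have hp : p ∉ (univ.filter fun i => p.succAbove i ∈ s).map p.succAboveEmb := by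
    simp [Fin.succAbove_ne]
  by_cases h : p ∈ s
  · refine Or.inr ⟨h, univ.filter fun i => p.succAbove i ∈ s, ?_⟩
    ext i
    by_cases hi : i = p
    · simp [hi, h]
    · rw [mem_insert, ← key i hi]; simp [hi]
  · refine Or.inl ⟨h, univ.filter fun i => p.succAbove i ∈ s, ?_⟩
    ext i
    by_cases hi : i = p
    · rw [hi]; exact iff_of_false h hp
    · exact key i hi

theorem notMem_map_succAbove {n : ℕ} (p : Fin (n + 1)) (s : Finset (Fin n)) :
    p ∉ s.map p.succAboveEmb := by
  simp [Fin.succAbove_ne]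

theorem supp_ins {n : ℕ} (p : Fin (n + 1)) (j : ℕ) (v : Fin n → ℕ) :
    supp (ins p j v) = if j = 0 then (supp v).map p.succAboveEmb
      else insert p ((supp v).map p.succAboveEmb) := by
  ext i
  rcases p.eq_self_or_eq_succAbove i with rfl | ⟨k, rfl⟩
  · split_ifs with h
    · simp [h, Fin.succAbove_ne]
    · simp [h]
  · split_ifs with h <;> simp [Fin.succAbove_ne]

theorem lev_zero_cmp {n : ℕ} (p : Fin (n + 1)) (F : Finset (Fin (n + 1)) → Prop) (d : ℕ) :
    lev p 0 (cmp F d) = cmp (del p F) d := by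
  ext v
  rw [mem_lev, mem_cmp, mem_cmp, supp_ins, if_pos rfl, Fin.sum_univ_succAbove _ p]
  simp [del]

theorem lev_succ_cmp {n : ℕ} (p : Fin (n + 1)) (F : Finset (Fin (n + 1)) → Prop) {d j : ℕ}
    (hj : j < d) : lev p (j + 1) (cmp F d) = cmp (lk p F) (d - (j + 1)) := by
  ext v
  rw [mem_lev, mem_cmp, mem_cmp, supp_ins, if_neg (Nat.succ_ne_zero j),
    Fin.sum_univ_succAbove _ p]
  simp only [ins_self, ins_succAbove, lk]
  exact and_congr_left fun _ => by omega

theorem Gotz.del {n : ℕ} {F : Finset (Fin (n + 1)) → Prop} (h : Gotz F) (p : Fin (n + 1)) :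
    Gotz (del p F) := fun d => by
  rw [← lev_zero_cmp]
  exact ((h d).lev p).1

/-- The link in degree `d` is level one of degree `d + 1`, so `Opt.lev` applies. In its first
alternative link and deletion agree in degree `d > 0`, because multiplying a monomial by a variable
already dividing it does not change its support; the deletion is Gotzmann. -/
theorem Gotz.lk {n : ℕ} {F : Finset (Fin (n + 1)) → Prop} (h : Gotz F) (hF : Monotone F)
    {p : Fin (n + 1)} (hp : ¬ F {p}) : Gotz (lk p F) := fun d => by
  have h1 := ((h (d + 1)).lev p).2 0 (Nat.succ_pos d)
  rw [lev_zero_cmp, lev_succ_cmp p F (Nat.succ_pos d)] at h1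
  simp only [zero_add, Nat.add_sub_cancel] at h1
  rcases h1 with h1 | h1
  · rcases d with _ | d
    · have : cmp (SqfGotzmann.lk p F) 0 = ∅ := by
        refine eq_empty_of_forall_notMem fun u hu => hp ?_
        have hu0 : u = 0 := by simpa [mons_zero_right] using cmp_subset _ _ hu
        subst hu0
        have : supp (0 : Fin n → ℕ) = ∅ := by ext; simp
        simpa [mem_cmp, this, SqfGotzmann.lk] using hu
      rw [this]
      exact opt_empty 0
    · have : cmp (SqfGotzmann.lk p F) (d + 1) = cmp (SqfGotzmann.del p F) (d + 1) := by
        refine Subset.antisymm (fun u hu => ?_) fun u hu => ?_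
        · obtain ⟨i, hi⟩ := exists_ne_zero_of_mem_mons_succ (cmp_subset _ _ hu)
          have h2 := mem_cmp.1 (h1 (add_single_mem_up hu i))
          have h3 : supp (u + Pi.single i 1) = supp u := by
            ext k
            simp only [mem_supp, Pi.add_apply, Pi.single_apply]
            split_ifs with hk
            · subst hk; simp [hi]
            · simp
          rw [h3] at h2
          exact mem_cmp.2 ⟨(mem_cmp.1 hu).1, h2.2⟩
        · exact mem_cmp.2 ⟨(mem_cmp.1 hu).1, del_le_lk hF p (mem_cmp.1 hu).2⟩
      rw [this]
      exact h.del p _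
  · exact h1

theorem gotz_iff_of_singleton {n : ℕ} {F : Finset (Fin (n + 1)) → Prop} (hF : Monotone F)
    {p : Fin (n + 1)} (hp : F {p}) : Gotz F ↔ Gotz (del p F) := by
  have : ∀ d, cmp F d = adj p d (cmp (SqfGotzmann.del p F) d) := by
    intro d
    ext u
    rw [eq_ins p u, ins_mem_adj, mem_cmp, mem_cmp, supp_ins, Fin.sum_univ_succAbove _ p]
    simp only [ins_self, ins_succAbove]
    refine and_congr_right fun h => ?_
    by_cases h0 : u p = 0
    · rw [h0] at h
      simp only [h0, if_true, true_imp_iff, SqfGotzmann.del]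
      exact ⟨fun h' => ⟨by omega, h'⟩, fun h' => h'.2⟩
    · simp only [h0, if_false, false_imp_iff, iff_true]
      exact hF (by simp) hp
  simp only [Gotz, this, opt_adj_iff p (cmp_subset _ _)]

/-- If `F'` does not depend on the variable `i`, then the product of `i` with `F'` is Gotzmann
whenever `F'` is. -/
theorem Gotz.mul {n : ℕ} {F F' : Finset (Fin n) → Prop} (h : Gotz F') {i : Fin n}
    (hF : ∀ s, F s ↔ i ∈ s ∧ F' s) (hF' : ∀ s, F' s ↔ F' (s.erase i)) : Gotz F := by
  intro d
  rcases d with _ | d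
  · have : cmp F 0 = ∅ := by
      refine eq_empty_of_forall_notMem fun u hu => ?_
      have hu0 : u = 0 := by simpa [mons_zero_right] using cmp_subset _ _ hu
      have := ((hF _).1 (mem_cmp.1 hu).2).1
      simp [hu0] at this
    rw [this]
    exact opt_empty 0
  · have : cmp F (d + 1) = mulVar i (cmp F' d) := by
      have hs : ∀ v : Fin n → ℕ, (supp (v + Pi.single i 1)).erase i = (supp v).erase i := by
        intro v
        ext k
        simp only [mem_erase, mem_supp, Pi.add_apply]
        exact and_congr_right fun hk => by rw [Pi.single_eq_of_ne hk, add_zero]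
      ext u
      rw [mem_cmp, hF, mulVar, mem_image]
      constructor
      · rintro ⟨h1, h2, h3⟩
        obtain ⟨v, rfl⟩ := exists_eq_add_single (mem_supp.1 h2)
        refine ⟨v, mem_cmp.2 ⟨?_, ?_⟩, rfl⟩
        · rw [sum_add_single] at h1; omega
        · rwa [hF', ← hs, ← hF']
      · rintro ⟨v, hv, rfl⟩
        rw [mem_cmp] at hv
        refine ⟨by rw [sum_add_single, hv.1], by simp, ?_⟩
        rw [hF', hs, ← hF']
        exact hv.2
    rw [this]
    exact (h d).mulVar i

theorem Gotz.map {n : ℕ} {F G : Finset (Fin n) → Prop} (h : Gotz F) (σ : Equiv.Perm (Fin n))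
    (hG : ∀ s, F s ↔ G (s.map σ.toEmbedding)) : Gotz G := by
  intro d
  have : cmp G d = renameVars σ.symm (cmp F d) := by
    ext u
    rw [mem_renameVars, mem_cmp, mem_cmp, hG, Equiv.symm_symm]
    have : (supp (u ∘ σ)).map σ.toEmbedding = supp u := by
      ext k; simp
    rw [this, ← Equiv.sum_comp σ u]
    rfl
  rw [this]
  exact (h d).renameVars _

/-! ### Gotzmann families without variables have a common variable -/

theorem up_union {n : ℕ} (A B : Finset (Fin n → ℕ)) : up (A ∪ B) = up A ∪ up B := by
  ext w
  simp only [mem_up, mem_union, or_and_right, exists_or]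

/-- Exchanging some members of an optimal set cannot make the shadow smaller. -/
theorem Opt.card_lost_le {n d : ℕ} {A R Q lost gain : Finset (Fin n → ℕ)} (hA : Opt d A)
    (hR : R ⊆ A) (hQ : Q ⊆ mons n d) (hQA : Disjoint Q A) (hc : Q.card = R.card)
    (hl : lost ⊆ up A) (hl' : ∀ w ∈ lost, w ∉ up (A \ R)) (hl'' : ∀ w ∈ lost, w ∉ up Q)
    (hg : up Q ⊆ up A ∪ gain) : lost.card ≤ gain.card := by
  have hB : (A \ R ∪ Q).card = A.card := by
    rw [card_union_of_disjoint (hQA.symm.mono_left sdiff_subset), card_sdiff_of_subset hR, hc]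
    have := card_le_card hR
    omega
  have h1 := hA.2 _ (union_subset (sdiff_subset.trans hA.1) hQ) hB
  have h2 : up (A \ R ∪ Q) ⊆ up A \ lost ∪ gain := by
    rw [up_union]
    refine union_subset (fun w hw => ?_) fun w hw => ?_
    · exact mem_union_left _ (mem_sdiff.2 ⟨up_mono sdiff_subset hw, fun h => hl' w h hw⟩)
    · rcases mem_union.1 (hg hw) with h | h
      · exact mem_union_left _ (mem_sdiff.2 ⟨h, fun h => hl'' w h hw⟩)
      · exact mem_union_right _ h
  have h3 := (card_le_card h2).trans (card_union_le _ _)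
  rw [card_sdiff_of_subset hl] at h3
  have := card_le_card hl
  omega

/-! ### Exchange arguments -/

/-- The exponent vector of the variable `i`. -/
def var {n : ℕ} (i : Fin n) : Fin n → ℕ := Pi.single i 1

theorem var_self {n : ℕ} (i : Fin n) : var i i = 1 := Pi.single_eq_same _ _

theorem var_of_ne {n : ℕ} {i k : Fin n} (h : k ≠ i) : var i k = 0 := Pi.single_eq_of_ne h _

theorem var_ne_zero_iff {n : ℕ} {i k : Fin n} : var i k ≠ 0 ↔ k = i := by
  simp [var, Pi.single_apply]

theorem var_inj {n : ℕ} {i k : Fin n} : var i = var k ↔ i = k := by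
  constructor
  · intro h
    have := congrFun h i
    rw [var_self, eq_comm] at this
    exact var_ne_zero_iff.1 (by omega)
  · rintro rfl; rfl

theorem sum_var {n : ℕ} (i : Fin n) : ∑ k, var i k = 1 := by
  simp [var]

theorem add_var_mem_up {n : ℕ} {A : Finset (Fin n → ℕ)} {u : Fin n → ℕ} (hu : u ∈ A)
    (i : Fin n) : u + var i ∈ up A := add_single_mem_up hu i

theorem var_add_ne_zero_iff {n : ℕ} {i j k : Fin n} :
    (var i + var j) k ≠ 0 ↔ k = i ∨ k = j := by
  rw [Pi.add_apply, ne_eq, Nat.add_eq_zero_iff, not_and_or]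
  exact or_congr var_ne_zero_iff var_ne_zero_iff

theorem supp_var_add {n : ℕ} (i j : Fin n) : supp (var i + var j) = {i, j} := by
  ext k
  rw [mem_supp, var_add_ne_zero_iff, mem_insert, mem_singleton]

theorem var_add_mem_cmp {n : ℕ} {F : Finset (Fin n) → Prop} {i j : Fin n} :
    var i + var j ∈ cmp F 2 ↔ F {i, j} := by
  rw [mem_cmp, supp_var_add]
  simp [sum_add_distrib, sum_var]

theorem var_add_eq {n : ℕ} {i j k l : Fin n} (h : var i + var j = var k + var l) (hik : i ≠ k) :
    i = l ∧ j = k := by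
  have h1 : i = l := by
    have h2 : (var k + var l) i ≠ 0 := by rw [← h, var_add_ne_zero_iff]; exact Or.inl rfl
    exact (var_add_ne_zero_iff.1 h2).resolve_left hik
  refine ⟨h1, ?_⟩
  subst h1
  rw [add_comm] at h
  exact var_inj.1 (add_right_cancel h)

theorem divisor_of_three {n : ℕ} {a : Fin n → ℕ} {i j k l : Fin n}
    (h : a + var l = var i + var j + var k) :
    a = var i + var j ∨ a = var j + var k ∨ a = var i + var k := by
  have h1 : l = i ∨ l = j ∨ l = k := by
    by_contra! hc
    have := congrFun h l
    simp [var_self, var_of_ne hc.1, var_of_ne hc.2.1, var_of_ne hc.2.2] at this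
  rcases h1 with rfl | rfl | rfl
  · right; left
    rw [add_assoc, add_comm (var l)] at h
    exact add_right_cancel h
  · right; right
    rw [add_right_comm] at h
    exact add_right_cancel h
  · left
    exact add_right_cancel h

section

variable {n : ℕ} {F : Finset (Fin n) → Prop}

open Classical in
/-- The variables whose product with `x` is a quadratic member of the family. -/
noncomputable def nb (F : Finset (Fin n) → Prop) (x : Fin n) : Finset (Fin n) :=
  univ.filter fun z => F {x, z}

theorem mem_nb {x z : Fin n} : z ∈ nb F x ↔ F {x, z} := by simp [nb]

theorem mem_nb_comm {x z : Fin n} : z ∈ nb F x ↔ x ∈ nb F z := by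
  rw [mem_nb, mem_nb, pair_comm]

theorem self_notMem_nb (h1 : ∀ i, ¬ F {i}) (x : Fin n) : x ∉ nb F x := by
  rw [mem_nb, pair_eq_singleton]; exact h1 x

/-- Exchange one quadratic member for the square of a variable. -/
theorem card_le_of_exchange_one (hG : Gotz F) (h1 : ∀ i, ¬ F {i}) {x y b : Fin n}
    (hyb : b ∈ nb F y) (hyx : y ≠ x) (hbx : b ≠ x) (Z : Finset (Fin n))
    (hZy : ∀ z ∈ Z, z ∈ nb F y → z = b) (hZb : ∀ z ∈ Z, z ∈ nb F b → z = y) :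
    Z.card + (nb F x).card ≤ n := by
  have hx : var x + var x ∉ cmp F 2 := by
    rw [var_add_mem_cmp, pair_eq_singleton]; exact h1 x
  -- Trade `y * b` for `x ^ 2`. For `z ∈ Z` the only member dividing `y * b * z` is `y * b`, so that
  -- cubic is lost; `x ^ 2 * z` is new only when `z` is not a neighbour of `x`.
  have hle := (hG 2).card_lost_le (R := {var y + var b}) (Q := {var x + var x})
    (lost := Z.image fun z => var y + var b + var z)
    (gain := (nb F x)ᶜ.image fun z => var x + var x + var z)
    (by simpa [var_add_mem_cmp] using mem_nb.1 hyb)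
    (by simp [mem_mons, sum_add_distrib, sum_var]) (by simpa using hx) rfl ?_ ?_ ?_ ?_
  · rw [card_image_of_injective _ fun z w h => var_inj.1 (add_left_cancel h)] at hle
    have := hle.trans card_image_le
    rw [card_compl, Fintype.card_fin] at this
    have := card_le_univ (nb F x)
    rw [Fintype.card_fin] at this
    omega
  · intro w hw
    obtain ⟨z, _, rfl⟩ := mem_image.1 hw
    exact add_var_mem_up (var_add_mem_cmp.2 (mem_nb.1 hyb)) z
  · intro w hw hw'
    obtain ⟨z, hz, rfl⟩ := mem_image.1 hw
    obtain ⟨a, ha, i, h⟩ := mem_up.1 hw'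
    rw [mem_sdiff, mem_singleton] at ha
    rcases divisor_of_three h.symm with h | h | h
    · exact ha.2 h
    · rw [h, var_add_mem_cmp] at ha
      rw [hZb z hz (mem_nb.2 ha.1), add_comm] at ha
      exact ha.2 rfl
    · rw [h, var_add_mem_cmp] at ha
      rw [hZy z hz (mem_nb.2 ha.1)] at ha
      exact ha.2 rfl
  · intro w hw hw'
    obtain ⟨z, _, rfl⟩ := mem_image.1 hw
    obtain ⟨a, ha, i, h⟩ := mem_up.1 hw'
    rw [mem_singleton] at ha
    subst ha
    have h2 := congrFun h x
    have h3 : var z x ≤ 1 := by simp only [var, Pi.single_apply]; split_ifs <;> omega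
    simp only [Pi.add_apply, var_self, var_of_ne hyx.symm, var_of_ne hbx.symm] at h2
    omega
  · intro w hw
    obtain ⟨a, ha, z, rfl⟩ := mem_up.1 hw
    rw [mem_singleton] at ha
    subst ha
    by_cases hz : z ∈ nb F x
    · refine mem_union_left _ ?_
      have := add_var_mem_up (var_add_mem_cmp.2 (mem_nb.1 hz)) x
      rwa [add_right_comm] at this
    · exact mem_union_right _ (mem_image.2 ⟨z, mem_compl.2 hz, rfl⟩)

/-- Exchange two quadratic members for `x ^ 2` and `x * y`. -/
theorem card_le_of_exchange_two (hG : Gotz F) (h1 : ∀ i, ¬ F {i}) {x y b c : Fin n}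
    (hyb : b ∈ nb F y) (hyc : c ∈ nb F y) (hbc : b ≠ c) (hyx : y ≠ x) (hxy : y ∉ nb F x)
    (hbx : b ≠ x) (hcx : c ≠ x) (hcov : ∀ s, F s → x ∉ s → y ∈ s) {Z W : Finset (Fin n)}
    (hxZ : x ∉ Z) (hxW : x ∉ W) (hZ : ∀ z ∈ Z, z ∈ nb F y → z = b ∨ z = c)
    (hW : ∀ z ∈ W, z ∈ nb F y → z = c) :
    Z.card + W.card + 2 * (nb F x).card ≤ 2 * n := by
  have hx : var x + var x ∉ cmp F 2 := by
    rw [var_add_mem_cmp, pair_eq_singleton]; exact h1 x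
  have hxy' : var x + var y ∉ cmp F 2 := by
    rw [var_add_mem_cmp]; exact fun h => hxy (mem_nb.2 h)
  have hby : b ≠ y := by rintro rfl; exact self_notMem_nb h1 _ hyb
  have hcy : c ≠ y := by rintro rfl; exact self_notMem_nb h1 _ hyc
  have hcov' : ∀ t z, t ≠ y → t ≠ x → z ≠ x → F {t, z} → z = y := by
    intro t z ht htx hz h
    have := hcov _ h (by simp [htx.symm, hz.symm])
    rw [mem_insert, mem_singleton] at this
    exact (this.resolve_left ht.symm).symm
  -- The cubic `y * b * c` must not be counted among the losses of both `y * b` and `y * c`.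
  have hbW : b ∉ W := fun h => hbc (hW b h hyb)
  have hdisj : Disjoint (Z.image fun z => var y + var b + var z)
      (W.image fun z => var y + var c + var z) := by
    rw [disjoint_left]
    intro w hw hw'
    obtain ⟨z, hz, rfl⟩ := mem_image.1 hw
    obtain ⟨t, ht, h⟩ := mem_image.1 hw'
    rw [add_assoc, add_assoc] at h
    have := (var_add_eq (add_left_cancel h) hbc.symm).2
    exact hbW (this ▸ ht)
  have hle := (hG 2).card_lost_le (R := {var y + var b, var y + var c})
    (Q := {var x + var x, var x + var y})
    (lost := (Z.image fun z => var y + var b + var z) ∪ W.image fun z => var y + var c + var z)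
    (gain := ((nb F x)ᶜ.image fun z => var x + var x + var z) ∪
      (nb F x)ᶜ.image fun z => var x + var y + var z)
    ?_ ?_ ?_ ?_ ?_ ?_ ?_ ?_
  · rw [card_union_of_disjoint hdisj,
      card_image_of_injective _ fun z w h => var_inj.1 (add_left_cancel h),
      card_image_of_injective _ fun z w h => var_inj.1 (add_left_cancel h)] at hle
    have := hle.trans ((card_union_le _ _).trans (add_le_add card_image_le card_image_le))
    rw [card_compl, Fintype.card_fin] at this
    have := card_le_univ (nb F x)
    rw [Fintype.card_fin] at this
    omega
  · intro w hw
    rw [mem_insert, mem_singleton] at hw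
    rcases hw with rfl | rfl
    · exact var_add_mem_cmp.2 (mem_nb.1 hyb)
    · exact var_add_mem_cmp.2 (mem_nb.1 hyc)
  · intro w hw
    rw [mem_insert, mem_singleton] at hw
    rcases hw with rfl | rfl <;> simp [mem_mons, sum_add_distrib, sum_var]
  · rw [disjoint_left]
    intro w hw
    rw [mem_insert, mem_singleton] at hw
    rcases hw with rfl | rfl
    · exact hx
    · exact hxy'
  · rw [card_pair fun h => hyx.symm (var_inj.1 (add_left_cancel h)),
      card_pair fun h => hbc (var_inj.1 (add_left_cancel h))]
  · intro w hw
    rcases mem_union.1 hw with hw | hw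
    · obtain ⟨z, _, rfl⟩ := mem_image.1 hw
      exact add_var_mem_up (var_add_mem_cmp.2 (mem_nb.1 hyb)) z
    · obtain ⟨z, _, rfl⟩ := mem_image.1 hw
      exact add_var_mem_up (var_add_mem_cmp.2 (mem_nb.1 hyc)) z
  · intro w hw hw'
    obtain ⟨a, ha, i, h⟩ := mem_up.1 hw'
    simp only [mem_sdiff, mem_insert, mem_singleton, not_or] at ha
    obtain ⟨ha, hab, hac⟩ := ha
    rcases mem_union.1 hw with hw | hw
    · obtain ⟨z, hz, rfl⟩ := mem_image.1 hw
      have hzx : z ≠ x := fun h => hxZ (h ▸ hz)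
      rcases divisor_of_three h.symm with rfl | rfl | rfl
      · exact hab rfl
      · rw [hcov' b z hby hbx hzx (var_add_mem_cmp.1 ha), add_comm] at hab
        exact hab rfl
      · rcases hZ z hz (mem_nb.2 (var_add_mem_cmp.1 ha)) with rfl | rfl
        · exact hab rfl
        · exact hac rfl
    · obtain ⟨z, hz, rfl⟩ := mem_image.1 hw
      have hzx : z ≠ x := fun h => hxW (h ▸ hz)
      rcases divisor_of_three h.symm with rfl | rfl | rfl
      · exact hac rfl
      · rw [hcov' c z hcy hcx hzx (var_add_mem_cmp.1 ha), add_comm] at hac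
        exact hac rfl
      · rw [hW z hz (mem_nb.2 (var_add_mem_cmp.1 ha))] at hac
        exact hac rfl
  · intro w hw hw'
    have hw0 : w x = 0 := by
      rcases mem_union.1 hw with hw | hw
      · obtain ⟨z, hz, rfl⟩ := mem_image.1 hw
        have hzx : x ≠ z := fun h => hxZ (h ▸ hz)
        simp [var_of_ne hyx.symm, var_of_ne hbx.symm, var_of_ne hzx]
      · obtain ⟨z, hz, rfl⟩ := mem_image.1 hw
        have hzx : x ≠ z := fun h => hxW (h ▸ hz)
        simp [var_of_ne hyx.symm, var_of_ne hcx.symm, var_of_ne hzx]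
    obtain ⟨a, ha, i, rfl⟩ := mem_up.1 hw'
    rw [mem_insert, mem_singleton] at ha
    rcases ha with rfl | rfl <;> simp [var_self] at hw0
  · intro w hw
    obtain ⟨a, ha, z, rfl⟩ := mem_up.1 hw
    rw [mem_insert, mem_singleton] at ha
    by_cases hz : z ∈ nb F x
    · refine mem_union_left _ ?_
      have := var_add_mem_cmp.2 (mem_nb.1 hz)
      rcases ha with rfl | rfl
      · have := add_var_mem_up this x
        rwa [add_right_comm] at this
      · have := add_var_mem_up this y
        rwa [add_right_comm] at this
    · refine mem_union_right _ ?_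
      rcases ha with rfl | rfl
      · exact mem_union_left _ (mem_image.2 ⟨z, mem_compl.2 hz, rfl⟩)
      · exact mem_union_right _ (mem_image.2 ⟨z, mem_compl.2 hz, rfl⟩)

/-- A family generated by a star with all possible edges at `x` and the product of the variables
other than `x` is not Gotzmann. -/
theorem not_gotz_of_star (hG : Gotz F) (hF : Monotone F) (h1 : ∀ i, ¬ F {i}) {x : Fin n}
    (hstar : ∀ z, z ≠ x → F {x, z}) (hn : 3 ≤ n) (hx : F (univ.erase x))
    (hun : ∀ s, F s → x ∉ s → s = univ.erase x) : False := by
  obtain ⟨e, rfl⟩ : ∃ e, n = e + 3 := ⟨n - 3, by omega⟩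
  set g : Fin (e + 3) → ℕ := fun k => if k = x then 0 else 1 with hg
  have hgs : ∑ k, g k = e + 2 := by
    rw [Fin.sum_univ_succAbove _ x]
    simp [hg, Fin.succAbove_ne]
  have hgsupp : supp g = univ.erase x := by ext k; simp [hg]
  have hgm : g ∈ cmp F (e + 2) := mem_cmp.2 ⟨hgs, hgsupp ▸ hx⟩
  have huniq : ∀ a ∈ cmp F (e + 2), a x = 0 → a = g := by
    intro a ha hax
    rw [mem_cmp] at ha
    have hs := hun _ ha.2 (by simp [hax])
    have hle : ∀ k ∈ univ, g k ≤ a k := by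
      intro k _
      simp only [hg]
      split_ifs with hk
      · exact Nat.zero_le _
      · have : k ∈ supp a := by rw [hs]; simp [hk]
        exact Nat.one_le_iff_ne_zero.2 (mem_supp.1 this)
    ext k
    exact ((sum_eq_sum_iff_of_le hle).1 (hgs.trans ha.1.symm) k (mem_univ k)).symm
  -- In degree `n - 1`, trade the product `g` of all variables but `x` for a power of `x`. The `n -
  -- 1 ≥ 2` products of `g` with variables other than `x` are lost, and only the next power of `x`
  -- is gained because all other multiples contain an edge at `x`.
  have hle := (hG (e + 2)).card_lost_le (R := {g}) (Q := {Pi.single x (e + 2)})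
    (lost := (univ.erase x).image fun k => g + var k) (gain := {Pi.single x (e + 3)})
    (by simpa using hgm) (by simp [mem_mons]) ?_ rfl ?_ ?_ ?_ ?_
  · rw [card_image_of_injective _ fun z w h => var_inj.1 (add_left_cancel h),
      card_erase_of_mem (mem_univ x), card_singleton, card_univ, Fintype.card_fin] at hle
    omega
  · rw [disjoint_singleton_left]
    intro h
    refine h1 x (hF ?_ (mem_cmp.1 h).2)
    intro k hk
    by_contra hc
    rw [mem_singleton] at hc
    simp [hc] at hk
  · intro w hw
    obtain ⟨k, _, rfl⟩ := mem_image.1 hw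
    exact add_var_mem_up hgm k
  · intro w hw hw'
    obtain ⟨k, hk, rfl⟩ := mem_image.1 hw
    obtain ⟨a, ha, i, h⟩ := mem_up.1 hw'
    rw [mem_sdiff, mem_singleton] at ha
    refine ha.2 (huniq a ha.1 ?_)
    have := congrFun h x
    simp only [Pi.add_apply, var_of_ne (ne_of_mem_erase hk).symm, hg, if_true] at this
    omega
  · intro w hw hw'
    obtain ⟨k, hk, rfl⟩ := mem_image.1 hw
    obtain ⟨a, ha, i, h⟩ := mem_up.1 hw'
    rw [mem_singleton] at ha
    subst ha
    have := congrFun h x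
    simp only [Pi.add_apply, var_of_ne (ne_of_mem_erase hk).symm, hg, if_true,
      Pi.single_eq_same] at this
    omega
  · intro w hw
    obtain ⟨a, ha, k, rfl⟩ := mem_up.1 hw
    rw [mem_singleton] at ha
    subst ha
    by_cases hk : k = x
    · subst hk
      refine mem_union_right _ ?_
      rw [← Pi.single_add, mem_singleton]
    · refine mem_union_left _ (mem_up.2 ⟨Pi.single x (e + 1) + Pi.single k 1, ?_, x, ?_⟩)
      · rw [mem_cmp]
        refine ⟨by simp [sum_add_distrib], hF ?_ (hstar k hk)⟩
        intro m hm
        rw [mem_insert, mem_singleton] at hm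
        rcases hm with rfl | rfl <;> simp
      · rw [add_right_comm, ← Pi.single_add]

/-- The induction step for `exists_common_variable`, when every variable divides a quadratic
member of the family. -/
theorem exists_common_variable_of_cover (hn : 0 < n) (hG : Gotz F) (hF : Monotone F)
    (h1 : ∀ i, ¬ F {i}) (hdeg : ∀ x, ∃ z, F {x, z})
    (hcov : ∀ x, ∃ y, y ≠ x ∧ ∀ s, F s → x ∉ s → y ∈ s) : ∃ x, ∀ s, F s → x ∈ s := by
  -- View quadratic members as edges of a graph and take a vertex `x` of maximal degree. An edge
  -- avoiding `x` will contradict maximality or optimality; without one the graph is a star at `x`.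
  obtain ⟨x, -, hmax⟩ := exists_max_image (univ : Finset (Fin n)) (fun x => (nb F x).card)
    ⟨⟨0, hn⟩, mem_univ _⟩
  replace hmax : ∀ z, (nb F z).card ≤ (nb F x).card := fun z => hmax z (mem_univ z)
  have hne : ∀ a b, F {a, b} → a ≠ b := by
    rintro a b h rfl
    rw [pair_eq_singleton] at h
    exact h1 a h
  by_cases hedge : ∃ a b, F {a, b} ∧ a ≠ x ∧ b ≠ x
  · exfalso
    obtain ⟨y, hyx, hy⟩ := hcov x
    obtain ⟨b, hyb, hbx⟩ : ∃ b ∈ nb F y, b ≠ x := by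
      obtain ⟨a, b, hab, hax, hbx⟩ := hedge
      have := hy _ hab (by simp [hax.symm, hbx.symm])
      rw [mem_insert, mem_singleton] at this
      rcases this with rfl | rfl
      · exact ⟨b, mem_nb.2 hab, hbx⟩
      · exact ⟨a, mem_nb.2 (by rwa [pair_comm]), hax⟩
    have hZb : ∀ b ≠ x, b ∈ nb F y → ∀ z, z ≠ x → z ∈ nb F b → z = y := by
      intro b hbx hyb z hz h
      have := hy _ (mem_nb.1 h) (by simp [hbx.symm, hz.symm])
      rw [mem_insert, mem_singleton] at this
      exact (this.resolve_left (hne _ _ (mem_nb.1 hyb))).symm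
    set P := (nb F y).erase x with hP
    have hxP : x ∉ P := notMem_erase _ _
    have hcardZ : ∀ S ⊆ P, (insert x S)ᶜ.card + S.card + 1 = n := by
      intro S hS
      have h2 := card_compl_add_card (insert x S)
      rw [card_insert_of_notMem fun h => hxP (hS h), Fintype.card_fin] at h2
      omega
    have hbP : b ∈ P := mem_erase.2 ⟨hbx, hyb⟩
    have hnotP : ∀ z, z ≠ x → z ∈ nb F y → z ∈ P := fun z hz h => mem_erase.2 ⟨hz, h⟩
    have hPle : P.card ≤ (nb F y).card := card_le_card (erase_subset _ _)
    have hPpos : ∀ b ∈ P, (P.erase b).card + 1 = P.card := fun b hb => card_erase_add_one hb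
    -- the number of quadratic members divisible by `y` but not by `x` is the degree of `x`
    have hr : (nb F x).card ≤ P.card := by
      have h2 := card_le_of_exchange_one hG h1 hyb hyx hbx (insert x (P.erase b))ᶜ
        (fun z hz hzy => by
          simp only [mem_compl, mem_insert, mem_erase, not_or, not_and_or, not_not] at hz
          exact hz.2.resolve_right fun h => h (hnotP z hz.1 hzy))
        (fun z hz h => by
          simp only [mem_compl, mem_insert, not_or] at hz
          exact hZb b hbx hyb z hz.1 h)
      have h3 := hcardZ (P.erase b) (erase_subset _ _)
      have h4 := hPpos b hbP
      omega
    have hxy : x ∉ nb F y := by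
      intro h
      have h2 := card_erase_add_one h
      rw [← hP] at h2
      have h3 := hmax y
      omega
    -- every neighbour of `y` is a neighbour of `x`
    have hxb : x ∈ nb F b := by
      by_contra hc
      have h2 := card_le_of_exchange_one hG h1 hyb hyx hbx (P.erase b)ᶜ
        (fun z hz hzy => by
          simp only [mem_compl, mem_erase, not_and_or, not_not] at hz
          exact hz.resolve_right fun h => h (hnotP z (fun h => hxy (h ▸ hzy)) hzy))
        (fun z hz h => hZb b hbx hyb z (fun h' => hc (h' ▸ h)) h)
      have h3 := card_compl_add_card (P.erase b)
      rw [Fintype.card_fin] at h3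
      have h4 := hPpos b hbP
      have := hmax y
      omega
    -- Since `b` has the two neighbours `x` and `y`, maximality gives `x` degree at least two. Hence
    -- `P` contains a second vertex `c`.
    have h2 : 2 ≤ (nb F b).card := by
      rw [← card_pair hyx.symm]
      refine card_le_card fun z hz => ?_
      rw [mem_insert, mem_singleton] at hz
      rcases hz with rfl | rfl
      · exact hxb
      · exact mem_nb_comm.1 hyb
    have hcard : (P.erase b).Nonempty := by
      rw [← card_pos]
      have := hPpos b hbP
      have := hmax b
      omega
    obtain ⟨c, hc⟩ := hcard
    have hcb := ne_of_mem_erase hc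
    have hcP := mem_of_mem_erase hc
    have hcx := ne_of_mem_erase hcP
    have hyc := mem_of_mem_erase hcP
    -- Here `Z` has `n - P.card + 1` elements and `W` has `n - P.card`. As `P.card` equals the
    -- degree of `x`, more cubics are lost than the `2 * (n - P.card)` that can be gained.
    have h3 := card_le_of_exchange_two hG h1 hyb hyc hcb.symm hyx (mem_nb_comm.not.1 hxy) hbx hcx
      hy (Z := (insert x ((P.erase b).erase c))ᶜ) (W := (insert x (P.erase c))ᶜ) (by simp) (by simp)
      (fun z hz hzy => by
          simp only [mem_compl, mem_insert, mem_erase, not_or, not_and_or, not_not] at hz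
          have := hnotP z hz.1 hzy
          tauto)
      (fun z hz hzy => by
          simp only [mem_compl, mem_insert, mem_erase, not_or, not_and_or, not_not] at hz
          have := hnotP z hz.1 hzy
          tauto)
    have h4 := hcardZ _ ((erase_subset c _).trans (erase_subset b P))
    have h5 := hcardZ _ (erase_subset c P)
    have h6 := hPpos b hbP
    have h7 := hPpos c hcP
    have h8 := card_erase_add_one hc
    have h9 := hmax y
    omega
  · push Not at hedge
    have hstar : ∀ z, z ≠ x → F {x, z} := by
      intro z hz
      obtain ⟨w, hw⟩ := hdeg z
      have := hedge z w hw hz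
      rw [this, pair_comm] at hw
      exact hw
    refine ⟨x, fun s hs => ?_⟩
    by_contra hxs
    have htwo : ∀ s, F s → ∀ y, ∃ c ∈ s, c ≠ y := by
      intro s hs y
      by_contra! hc
      exact h1 y (hF (fun z hz => mem_singleton.2 (hc z hz)) hs)
    -- If `s` missed some `b ≠ x`, the variable `y` common to members avoiding `b` would lie in `s`.
    -- A star edge from `x` to another element of `s` also avoids `b` but misses `y`.
    have hun : ∀ s, F s → x ∉ s → s = univ.erase x := by
      intro s hs hxs
      ext b
      simp only [mem_erase, mem_univ, and_true]
      refine ⟨fun h h' => hxs (h' ▸ h), fun hbx => ?_⟩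
      by_contra hbs
      obtain ⟨y, hyb, hy⟩ := hcov b
      have hys := hy s hs hbs
      obtain ⟨c, hcs, hcy⟩ := htwo s hs y
      have hcx : c ≠ x := fun h => hxs (h ▸ hcs)
      have hcb : c ≠ b := fun h => hbs (h ▸ hcs)
      have := hy _ (hstar c hcx) (by simp [hbx, hcb.symm])
      rw [mem_insert, mem_singleton] at this
      rcases this with rfl | rfl
      · exact hxs hys
      · exact hcy rfl
    have hs' := hun s hs hxs
    refine not_gotz_of_star hG hF h1 hstar ?_ (hs' ▸ hs) hun
    obtain ⟨a, ha, hax⟩ := htwo s hs x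
    obtain ⟨b, hb, hba⟩ := htwo s hs a
    have hbx : b ≠ x := fun h => hxs (h ▸ hb)
    have := card_le_univ ({x, a, b} : Finset (Fin n))
    rwa [card_eq_three.2 ⟨x, a, b, hax.symm, hbx.symm, hba.symm, rfl⟩, Fintype.card_fin] at this

end

/-- The generators of a squarefree Gotzmann ideal without linear forms share a variable. -/
theorem exists_common_variable {n : ℕ} {F : Finset (Fin (n + 1)) → Prop} (hG : Gotz F)
    (hF : Monotone F) (h0 : ¬ F ∅) (h1 : ∀ i, ¬ F {i}) : ∃ x, ∀ s, F s → x ∈ s := by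
  induction n with
  | zero =>
    refine ⟨0, fun s hs => ?_⟩
    by_contra hc
    refine h0 (hF (fun i hi => ?_) hs)
    rw [Fin.fin_one_eq_zero i] at hi
    exact absurd hi hc
  | succ n ih =>
    -- If some link contains no variable, its common variable works for `F`, since the deletion lies
    -- inside the link. Otherwise every variable occurs in a quadratic member, and induction on the
    -- deletions gives common variables of the members avoiding each `x`.
    by_cases hlk : ∃ x, ∀ i, ¬ lk x F {i}
    · obtain ⟨x, hx⟩ := hlk
      obtain ⟨z, hz⟩ := ih (hG.lk hF (h1 x)) (lk_mono hF x) (by simpa [lk] using h1 x) hx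
      refine ⟨x.succAbove z, fun s hs => ?_⟩
      rcases eq_map_or_eq_insert x s with ⟨_, t, rfl⟩ | ⟨_, t, rfl⟩
      · have := hz t (del_le_lk hF x hs)
        simpa using this
      · have := hz t hs
        simp [this]
    · push Not at hlk
      refine exists_common_variable_of_cover (Nat.succ_pos _) hG hF h1 (fun x => ?_) fun x => ?_
      · obtain ⟨i, hi⟩ := hlk x
        exact ⟨x.succAbove i, by simpa [lk] using hi⟩
      · obtain ⟨z, hz⟩ := ih (hG.del x) (del_mono hF x) (by simpa [del] using h0)
          (fun i => by simpa [del] using h1 _)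
        refine ⟨x.succAbove z, Fin.succAbove_ne _ _, fun s hs hxs => ?_⟩
        rcases eq_map_or_eq_insert x s with ⟨_, t, rfl⟩ | ⟨hx, _⟩
        · have := hz t hs
          simpa using this
        · exact absurd hx hxs

/-! ### The families of the squarefree Gotzmann ideals -/

/-- The family on the remaining variables once the variable `0` is forgotten. -/
def tl {n : ℕ} (s : Finset (Fin (n + 1))) : Finset (Fin n) := univ.filter fun i => i.succ ∈ s

@[simp] theorem mem_tl {n : ℕ} {s : Finset (Fin (n + 1))} {i : Fin n} : i ∈ tl s ↔ i.succ ∈ s := by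
  simp [tl]

/-- The family encoded by the binary digits of `k`: reading the digits from the most significant
one, a digit `1` adds a new variable as a generator and a digit `0` multiplies by a new
variable. -/
def fam : (n : ℕ) → ℕ → Finset (Fin n) → Prop
  | 0, _ => fun _ => False
  | n + 1, k => fun s =>
    if 2 ^ n ≤ k then 0 ∈ s ∨ fam n (k - 2 ^ n) (tl s) else 0 ∈ s ∧ fam n k (tl s)

theorem fam_succ_of_le {n k : ℕ} (h : 2 ^ n ≤ k) (s : Finset (Fin (n + 1))) :
    fam (n + 1) k s ↔ 0 ∈ s ∨ fam n (k - 2 ^ n) (tl s) := by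
  simp [fam, h]

theorem fam_succ_of_lt {n k : ℕ} (h : k < 2 ^ n) (s : Finset (Fin (n + 1))) :
    fam (n + 1) k s ↔ 0 ∈ s ∧ fam n k (tl s) := by
  simp [fam, not_le.2 h]

theorem tl_mono {n : ℕ} : Monotone (tl (n := n)) := fun _ _ h _ hi => mem_tl.2 (h (mem_tl.1 hi))

theorem fam_mono (n k : ℕ) : Monotone (fam n k) := by
  induction n generalizing k with
  | zero => exact fun _ _ _ h => h
  | succ n ih =>
    intro s t hst
    rcases le_or_gt (2 ^ n) k with h | h
    · simp only [fam_succ_of_le h]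
      exact Or.imp (@hst 0) (ih _ (tl_mono hst))
    · simp only [fam_succ_of_lt h]
      exact And.imp (@hst 0) (ih _ (tl_mono hst))

theorem tl_empty {n : ℕ} : tl (∅ : Finset (Fin (n + 1))) = ∅ := by ext; simp

theorem not_fam_empty (n k : ℕ) : ¬ fam n k ∅ := by
  induction n generalizing k with
  | zero => exact fun h => h
  | succ n ih =>
    rcases le_or_gt (2 ^ n) k with h | h
    · rw [fam_succ_of_le h, tl_empty]; simp [ih]
    · rw [fam_succ_of_lt h]; simp

theorem not_fam_zero (n : ℕ) (s : Finset (Fin n)) : ¬ fam n 0 s := by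
  induction n with
  | zero => exact fun h => h
  | succ n ih => rw [fam_succ_of_lt (by positivity)]; exact fun h => ih _ h.2

theorem tl_map {n : ℕ} (s : Finset (Fin n)) : tl (s.map (Fin.succAboveEmb 0)) = s := by
  ext i; simp

theorem tl_insert {n : ℕ} (s : Finset (Fin n)) :
    tl (insert 0 (s.map (Fin.succAboveEmb 0))) = s := by
  ext i; simp

theorem del_fam_of_le {n k : ℕ} (h : 2 ^ n ≤ k) :
    del 0 (fam (n + 1) k) = fam n (k - 2 ^ n) := by
  ext s
  rw [del, fam_succ_of_le h, tl_map]
  simp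

theorem lk_fam_of_le {n k : ℕ} (h : 2 ^ n ≤ k) (s : Finset (Fin n)) :
    lk 0 (fam (n + 1) k) s := by
  rw [lk, fam_succ_of_le h]
  simp

theorem not_del_fam_of_lt {n k : ℕ} (h : k < 2 ^ n) (s : Finset (Fin n)) :
    ¬ del 0 (fam (n + 1) k) s := by
  rw [del, fam_succ_of_lt h]
  simp

theorem lk_fam_of_lt {n k : ℕ} (h : k < 2 ^ n) : lk 0 (fam (n + 1) k) = fam n k := by
  ext s
  rw [lk, fam_succ_of_lt h, tl_insert]
  simp

/-- The family `fam n k`, viewed in `n + 1` variables. -/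
theorem fam_succ_two_mul {n k : ℕ} (hk : k < 2 ^ n) (s : Finset (Fin (n + 1))) :
    fam (n + 1) (2 * k) s ↔ fam n k (univ.filter fun i => i.castSucc ∈ s) := by
  induction n generalizing k with
  | zero =>
    obtain rfl : k = 0 := by simpa using hk
    exact iff_of_false (not_fam_zero _ _) fun h => h
  | succ n ih =>
    have htl : (univ.filter fun i : Fin n => i.castSucc ∈ tl s) =
        tl (univ.filter fun i : Fin (n + 1) => i.castSucc ∈ s) := by
      ext i; simp
    have h0 : (0 : Fin (n + 1)) ∈ (univ.filter fun i : Fin (n + 1) => i.castSucc ∈ s) ↔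
        (0 : Fin (n + 2)) ∈ s := by simp
    have hp : 2 ^ (n + 1) = 2 * 2 ^ n := by ring
    rcases le_or_gt (2 ^ n) k with h | h
    · rw [fam_succ_of_le h, fam_succ_of_le (by omega), h0, ← htl, ← ih (by omega), hp,
        Nat.mul_sub]
    · rw [fam_succ_of_lt h, fam_succ_of_lt (by omega), h0, ← htl, ← ih h]

theorem gotz_of_forall_not {n : ℕ} {F : Finset (Fin n) → Prop} (h : ∀ s, ¬ F s) : Gotz F := by
  intro d
  have : cmp F d = ∅ := eq_empty_of_forall_notMem fun u hu => h _ (mem_cmp.1 hu).2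
  rw [this]
  exact opt_empty d

/-- A leading digit `1` is removed by deletion. For a leading digit `0` the cofactor must be
Gotzmann in `n + 1` variables, which is stronger than being Gotzmann in `n`: the square of the
maximal ideal in two variables fails to stay Gotzmann in three. Up to rotation the extended cofactor
is `fam (n + 1) (2 * k)`, so the inner induction runs towards larger `k`. -/
theorem gotz_fam {n k : ℕ} (hk : k < 2 ^ n) : Gotz (fam n k) := by
  induction n generalizing k with
  | zero => exact gotz_of_forall_not fun _ h => h
  | succ n ih =>
    have hp : 2 ^ (n + 1) = 2 * 2 ^ n := by ring
    induction hm : 2 ^ (n + 1) - k using Nat.strong_induction_on generalizing k with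
    | _ m ihm =>
      subst hm
      rcases le_or_gt (2 ^ n) k with h | h
      · rw [gotz_iff_of_singleton (fam_mono _ _) (p := 0) ((fam_succ_of_le h _).2 (by simp)),
          del_fam_of_le h]
        exact ih (by omega)
      · rcases Nat.eq_zero_or_pos k with rfl | h0
        · exact gotz_of_forall_not (not_fam_zero _)
        -- The family of `2 * k` omits the last variable, whereas the cofactor omits variable `0`; a
        -- rotation exchanges these roles.
        have hrot : ∀ i : Fin n, finRotate (n + 1) i.castSucc = i.succ := fun i => by
          rw [finRotate_apply, Fin.coeSucc_eq_succ]
        have h2 : Gotz (fun s : Finset (Fin (n + 1)) => fam n k (tl s)) := by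
          refine (ihm _ (by omega) (k := 2 * k) (by omega) rfl).map (finRotate (n + 1)) fun s => ?_
          rw [fam_succ_two_mul h]
          have : (univ.filter fun i : Fin n => i.castSucc ∈ s) =
              tl (s.map (finRotate (n + 1)).toEmbedding) := by
            ext i
            rw [mem_tl, ← hrot i, mem_filter, and_iff_right (mem_univ i)]
            exact (mem_map' (finRotate (n + 1)).toEmbedding).symm
          rw [this]
        refine h2.mul (i := 0) (fun s => fam_succ_of_lt h s) fun s => ?_
        have : tl (s.erase 0) = tl s := by ext i; simp
        simp only [this]

/-! ### Classification -/

open Classical in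
/-- The number of members of a family. -/
noncomputable def famCard {n : ℕ} (F : Finset (Fin n) → Prop) : ℕ := (univ.filter F).card

theorem famCard_eq {n : ℕ} (p : Fin (n + 1)) (F : Finset (Fin (n + 1)) → Prop) :
    famCard F = famCard (del p F) + famCard (lk p F) := by
  classical
  have hinj : Function.Injective fun t : Finset (Fin n) => insert p (t.map p.succAboveEmb) := by
    intro s t h
    have h' := congrArg (fun s => Finset.erase s p) h
    simp only [erase_insert (notMem_map_succAbove _ _)] at h'
    exact map_injective _ h'
  rw [famCard, famCard, famCard, ← card_image_of_injective _ (map_injective p.succAboveEmb),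
    ← card_image_of_injective (univ.filter (lk p F)) hinj, ← card_union_of_disjoint]
  · congr 1
    ext s
    simp only [mem_filter, mem_univ, true_and, mem_union, mem_image]
    constructor
    · intro h
      rcases eq_map_or_eq_insert p s with ⟨_, t, rfl⟩ | ⟨_, t, rfl⟩
      · exact Or.inl ⟨t, h, rfl⟩
      · exact Or.inr ⟨t, h, rfl⟩
    · rintro (⟨t, h, rfl⟩ | ⟨t, h, rfl⟩)
      · exact h
      · exact h
  · rw [disjoint_left]
    intro s hs hs'
    obtain ⟨t, _, rfl⟩ := mem_image.1 hs
    obtain ⟨t', _, h⟩ := mem_image.1 hs'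
    exact notMem_map_succAbove p t (h ▸ mem_insert_self _ _)

theorem famCard_congr {n : ℕ} {F G : Finset (Fin n) → Prop} (σ : Equiv.Perm (Fin n))
    (h : ∀ s, F s ↔ G (s.map σ.toEmbedding)) : famCard F = famCard G := by
  classical
  exact card_equiv σ.finsetCongr fun s => by simp [h]

theorem famCard_of_forall_not {n : ℕ} {F : Finset (Fin n) → Prop} (h : ∀ s, ¬ F s) :
    famCard F = 0 := by
  simp [famCard, h]

theorem famCard_of_forall {n : ℕ} {F : Finset (Fin n) → Prop} (h : ∀ s, F s) :
    famCard F = 2 ^ n := by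
  simp [famCard, h]

/-- A leading digit `1` contributes all `2 ^ n` sets containing variable `0`, a leading digit `0`
contributes nothing beyond the remaining digits. The binary expansion is thus summed up, and `k` is
recovered from the family. -/
theorem famCard_fam {n k : ℕ} (hk : k < 2 ^ n) : famCard (fam n k) = k := by
  induction n generalizing k with
  | zero =>
    obtain rfl : k = 0 := by simpa using hk
    exact famCard_of_forall_not fun _ h => h
  | succ n ih =>
    have hp : 2 ^ (n + 1) = 2 * 2 ^ n := by ring
    rw [famCard_eq 0]
    rcases le_or_gt (2 ^ n) k with h | h
    · rw [del_fam_of_le h, famCard_of_forall (lk_fam_of_le h), ih (by omega)]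
      omega
    · rw [lk_fam_of_lt h, famCard_of_forall_not (not_del_fam_of_lt h), ih h, zero_add]

/-- Extend a permutation of the variables other than `x`, sending `x` to `0`. -/
def extPerm {n : ℕ} (x : Fin (n + 1)) (τ : Equiv.Perm (Fin n)) : Equiv.Perm (Fin (n + 1)) :=
  (finSuccEquiv' x).trans (τ.optionCongr.trans (finSuccEquiv' 0).symm)

theorem extPerm_self {n : ℕ} (x : Fin (n + 1)) (τ : Equiv.Perm (Fin n)) : extPerm x τ x = 0 := by
  simp [extPerm]

theorem extPerm_succAbove {n : ℕ} (x : Fin (n + 1)) (τ : Equiv.Perm (Fin n)) (i : Fin n) :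
    extPerm x τ (x.succAbove i) = (τ i).succ := by
  simp [extPerm]

theorem zero_mem_map_extPerm {n : ℕ} (x : Fin (n + 1)) (τ : Equiv.Perm (Fin n))
    (s : Finset (Fin (n + 1))) : 0 ∈ s.map (extPerm x τ).toEmbedding ↔ x ∈ s := by
  rw [← extPerm_self x τ]
  exact mem_map' _

theorem tl_map_extPerm {n : ℕ} (x : Fin (n + 1)) (τ : Equiv.Perm (Fin n)) {t : Finset (Fin n)}
    {s : Finset (Fin (n + 1))} (h : s = t.map x.succAboveEmb ∨ s = insert x (t.map x.succAboveEmb)) :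
    tl (s.map (extPerm x τ).toEmbedding) = t.map τ.toEmbedding := by
  have hmem : ∀ i, x.succAbove i ∈ s ↔ i ∈ t := by
    intro i
    rcases h with rfl | rfl <;> simp [Fin.succAbove_ne]
  ext i
  obtain ⟨i, rfl⟩ := τ.surjective i
  rw [mem_tl, ← extPerm_succAbove x τ]
  exact (mem_map' (extPerm x τ).toEmbedding).trans ((hmem i).trans (mem_map' τ.toEmbedding).symm)

/-- Every nonunit squarefree Gotzmann ideal is, up to reordering, given by some `fam n k`. -/
theorem Gotz.exists_fam {n : ℕ} {F : Finset (Fin n) → Prop} (hG : Gotz F) (hF : Monotone F)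
    (h0 : ¬ F ∅) : ∃ k < 2 ^ n, ∃ σ : Equiv.Perm (Fin n),
      ∀ s, F s ↔ fam n k (s.map σ.toEmbedding) := by
  induction n with
  | zero =>
    refine ⟨0, by simp, 1, fun s => iff_of_false (fun h => h0 ?_) fun h => h⟩
    rwa [Subsingleton.elim ∅ s]
  | succ n ih =>
    have hp : 2 ^ (n + 1) = 2 * 2 ^ n := by ring
    -- A variable in the ideal gives digit `1`; otherwise the common variable gives digit `0`.
    by_cases h1 : ∃ x, F {x}
    · obtain ⟨x, hx⟩ := h1
      obtain ⟨k, hk, τ, h⟩ := ih (hG.del x) (del_mono hF x) (by simpa [SqfGotzmann.del] using h0)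
      refine ⟨k + 2 ^ n, by omega, extPerm x τ, fun s => ?_⟩
      rw [fam_succ_of_le (by omega), Nat.add_sub_cancel, zero_mem_map_extPerm]
      rcases eq_map_or_eq_insert x s with ⟨hxs, t, ht⟩ | ⟨hxs, t, ht⟩
      · rw [tl_map_extPerm x τ (Or.inl ht), ← h]
        simp [SqfGotzmann.del, ht]
      · exact iff_of_true (hF (by simpa using hxs) hx) (Or.inl hxs)
    · push Not at h1
      obtain ⟨x, hx⟩ := exists_common_variable hG hF h0 h1
      obtain ⟨k, hk, τ, h⟩ := ih (hG.lk hF (h1 x)) (lk_mono hF x)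
        (by simpa [SqfGotzmann.lk] using h1 x)
      refine ⟨k, by omega, extPerm x τ, fun s => ?_⟩
      rw [fam_succ_of_lt hk, zero_mem_map_extPerm]
      rcases eq_map_or_eq_insert x s with ⟨hxs, t, ht⟩ | ⟨hxs, t, ht⟩
      · exact iff_of_false (fun h => hxs (hx s h)) fun h => hxs h.1
      · rw [tl_map_extPerm x τ (Or.inr ht), ← h]
        simp [SqfGotzmann.lk, ht]

theorem exists_fam_singleton_iff {n k : ℕ} : (∃ i, fam (n + 1) k {i}) ↔ 2 ^ n ≤ k := by
  constructor
  · rintro ⟨i, hi⟩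
    by_contra! h
    rw [fam_succ_of_lt h] at hi
    have : tl ({i} : Finset (Fin (n + 1))) = ∅ := by
      ext m
      rw [← mem_singleton.1 hi.1]
      simp
    rw [this] at hi
    exact not_fam_empty _ _ hi.2
  · intro h
    exact ⟨0, (fam_succ_of_le h _).2 (by simp)⟩

/-- The family `fam (n + 1) k` comes from fewer variables if and only if `k` is even. -/
theorem exists_fam_erase_iff {n k : ℕ} (hk : k < 2 ^ (n + 1)) :
    (∃ i, ∀ s, fam (n + 1) k s → fam (n + 1) k (s.erase i)) ↔ Even k := by
  constructor
  · rintro ⟨i, hi⟩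
    -- Independence of variable `i` makes deletion and link coincide, so `k` is twice the size of
    -- either.
    have : del i (fam (n + 1) k) = lk i (fam (n + 1) k) := by
      ext s
      refine ⟨del_le_lk (fam_mono _ _) i, fun h => ?_⟩
      have := hi _ h
      rwa [erase_insert (notMem_map_succAbove _ _)] at this
    rw [← famCard_fam hk, famCard_eq i, this]
    exact ⟨_, rfl⟩
  · rintro ⟨m, rfl⟩
    have hm : m < 2 ^ n := by rw [pow_succ] at hk; omega
    refine ⟨Fin.last n, fun s h => ?_⟩
    rw [← two_mul, fam_succ_two_mul hm] at h ⊢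
    refine fam_mono _ _ (fun i hi => ?_) h
    simpa [(Fin.castSucc_lt_last i).ne] using hi

end SqfGotzmann

namespace SqfGotzmann

open Finset MvPolynomial

/-! ### From vector spaces of forms to sets of monomials -/

section Monomials

variable (K : Type*) [Field K] {n : ℕ}

/-- The span of the monomials with exponent vectors in `A`. -/
noncomputable def monSpan (A : Finset (Fin n → ℕ)) : Submodule K (MvPolynomial (Fin n) K) :=
  restrictSupport K {a : Fin n →₀ ℕ | ⇑a ∈ A}

variable {K}

theorem mem_monSpan {A : Finset (Fin n → ℕ)} {f : MvPolynomial (Fin n) K} :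
    f ∈ monSpan K A ↔ ∀ a ∈ f.support, ⇑a ∈ A := Iff.rfl

theorem monSpan_mons (d : ℕ) : monSpan K (mons n d) = homogeneousSubmodule (Fin n) K d := by
  ext f
  rw [homogeneousSubmodule_eq_finsupp_supported, mem_monSpan]
  refine forall₂_congr fun a _ => ?_
  rw [mem_mons]
  change _ ↔ a.degree = d
  rw [Finsupp.degree_eq_sum]

/-- The exponent vectors of `A`, as finitely supported functions. -/
noncomputable def monEquiv (A : Finset (Fin n → ℕ)) : {a : Fin n →₀ ℕ | ⇑a ∈ A} ≃ A :=
  Finsupp.equivFunOnFinite.subtypeEquiv fun _ => Iff.rfl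

instance (A : Finset (Fin n → ℕ)) : Module.Finite K (monSpan K A) :=
  haveI : Finite {a : Fin n →₀ ℕ | ⇑a ∈ A} := Finite.of_equiv _ (monEquiv A).symm
  Module.Finite.of_basis (basisRestrictSupport K {a : Fin n →₀ ℕ | ⇑a ∈ A})

theorem finrank_monSpan (A : Finset (Fin n → ℕ)) : Module.finrank K (monSpan K A) = A.card := by
  rw [monSpan, Module.finrank_eq_nat_card_basis (basisRestrictSupport K _),
    Nat.card_congr (monEquiv A), Nat.card_eq_fintype_card, Fintype.card_coe]

open scoped Pointwise in
theorem growth_monSpan (A : Finset (Fin n → ℕ)) : growth (monSpan K A) = monSpan K (up A) := by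
  rw [growth, ← monSpan_mons, monSpan, monSpan, monSpan, ← restrictSupport_add]
  congr 1
  ext a
  rw [Set.mem_add]
  constructor
  · rintro ⟨b, hb, c, hc, rfl⟩
    have hb' : ∑ i, b i = 1 := mem_mons.1 hb
    obtain ⟨i, hi⟩ := exists_ne_zero_of_mem_mons_succ (d := 0) hb
    obtain ⟨v, hv⟩ := exists_eq_add_single hi
    have hv0 : v = 0 := by
      rw [hv, sum_add_single] at hb'
      ext k
      exact (sum_eq_zero_iff.1 (Nat.succ.inj hb') k (mem_univ k))
    refine mem_up.2 ⟨c, hc, i, ?_⟩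
    rw [Finsupp.coe_add, hv, hv0, zero_add, add_comm]
  · intro h
    obtain ⟨u, hu, i, h⟩ := mem_up.1 h
    refine ⟨Finsupp.single i 1, ?_, Finsupp.equivFunOnFinite.symm u, hu, ?_⟩
    · change _ ∈ mons n 1
      rw [mem_mons, ← Finsupp.degree_eq_sum, Finsupp.degree_single]
    · ext k
      rw [h]
      simp [Finsupp.single_eq_pi_single, add_comm]

/-! ### Leading monomials -/

open Classical in
/-- The exponent vectors of the leading monomials of the forms of degree `d` in `W`. -/
noncomputable def leads (d : ℕ) (W : Submodule K (MvPolynomial (Fin n) K)) :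
    Finset (Fin n → ℕ) :=
  (mons n d).filter fun u => ∃ f ∈ W, f ≠ 0 ∧ ⇑(MonomialOrder.lex.degree f) = u

theorem mem_leads {d : ℕ} {W : Submodule K (MvPolynomial (Fin n) K)}
    (hW : W ≤ monSpan K (mons n d)) {u : Fin n → ℕ} :
    u ∈ leads d W ↔ ∃ f ∈ W, f ≠ 0 ∧ ⇑(MonomialOrder.lex.degree f) = u := by
  simp only [leads, mem_filter, and_iff_right_iff_imp]
  rintro ⟨f, hf, h0, rfl⟩
  exact mem_monSpan.1 (hW hf) _ (MonomialOrder.degree_mem_support h0)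

theorem finite_of_le_monSpan {d : ℕ} {W : Submodule K (MvPolynomial (Fin n) K)}
    (hW : W ≤ monSpan K (mons n d)) : Module.Finite K W :=
  Module.Finite.of_injective (Submodule.inclusion hW) (Submodule.inclusion_injective hW)

/-- An element of `W` is zero once its coefficients at all leading exponents of `W` vanish, since
its own leading coefficient is among them. -/
theorem finrank_le_card_leads {d : ℕ} {W : Submodule K (MvPolynomial (Fin n) K)}
    (hW : W ≤ monSpan K (mons n d)) : Module.finrank K W ≤ (leads d W).card := by
  let φ : W →ₗ[K] (leads d W → K) :=
    LinearMap.pi fun u => (lcoeff K (Finsupp.equivFunOnFinite.symm u.1)).comp W.subtype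
  have hφ : Function.Injective φ := by
    rw [← LinearMap.ker_eq_bot, LinearMap.ker_eq_bot']
    intro f hf
    by_contra h0
    have h0' : (f : MvPolynomial (Fin n) K) ≠ 0 := fun h => h0 (Subtype.ext h)
    have hmem := (mem_leads hW).2 ⟨f, f.2, h0', rfl⟩
    have h1 := congrFun hf ⟨_, hmem⟩
    refine MonomialOrder.lex.coeff_degree_ne_zero_iff.2 h0' ?_
    simpa [φ] using h1
  refine (LinearMap.finrank_le_finrank_of_injective hφ).trans ?_
  simp

/-- Forms with distinct leading monomials are linearly independent: the largest leading monomial in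
a relation cannot cancel. -/
theorem card_leads_le_finrank {d : ℕ} {W : Submodule K (MvPolynomial (Fin n) K)}
    (hW : W ≤ monSpan K (mons n d)) : (leads d W).card ≤ Module.finrank K W := by
  classical
  have hfin := finite_of_le_monSpan hW
  choose f hf h0 hd using fun u : leads d W => (mem_leads hW).1 u.2
  have hli : LinearIndependent K fun u => (⟨f u, hf u⟩ : W) := by
    rw [linearIndependent_iff']
    intro s c hsum u hu
    by_contra hc
    obtain ⟨v, hv, hmax⟩ := exists_max_image (s.filter fun u => c u ≠ 0)
      (fun u => MonomialOrder.lex.toSyn (MonomialOrder.lex.degree (f u))) ⟨u, by simp [hu, hc]⟩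
    rw [mem_filter] at hv
    have h1 := congrArg (fun w : W => coeff (MonomialOrder.lex.degree (f v)) (w : MvPolynomial _ K))
      hsum
    simp only [Submodule.coe_sum, Submodule.coe_smul, coeff_sum, coeff_smul, Submodule.coe_zero,
      coeff_zero, smul_eq_mul] at h1
    rw [sum_eq_single v] at h1
    · rcases mul_eq_zero.1 h1 with h | h
      · exact hv.2 h
      · exact MonomialOrder.lex.coeff_degree_ne_zero_iff.2 (h0 v) h
    · intro w hw hwv
      by_cases hcw : c w = 0
      · rw [hcw, zero_mul]
      · rw [MonomialOrder.lex.coeff_eq_zero_of_lt, mul_zero]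
        refine lt_of_le_of_ne (hmax w (mem_filter.2 ⟨hw, hcw⟩)) fun h => hwv ?_
        have := MonomialOrder.lex.toSyn.injective h
        exact Subtype.ext (by rw [← hd w, ← hd v, this])
    · exact fun h => absurd hv.1 h
  have := hli.fintype_card_le_finrank
  rwa [Fintype.card_coe] at this

theorem growth_mono {V W : Submodule K (MvPolynomial (Fin n) K)} (h : V ≤ W) :
    growth V ≤ growth W := mul_le_mul_right h _

theorem growth_le_monSpan {d : ℕ} {V : Submodule K (MvPolynomial (Fin n) K)}
    (hV : V ≤ monSpan K (mons n d)) : growth V ≤ monSpan K (mons n (d + 1)) := by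
  refine (growth_mono hV).trans ?_
  rw [growth_monSpan, up_mons]

theorem up_leads_subset {d : ℕ} {V : Submodule K (MvPolynomial (Fin n) K)}
    (hV : V ≤ monSpan K (mons n d)) : up (leads d V) ⊆ leads (d + 1) (growth V) := by
  intro w hw
  obtain ⟨u, hu, i, rfl⟩ := mem_up.1 hw
  obtain ⟨f, hf, h0, rfl⟩ := (mem_leads hV).1 hu
  refine (mem_leads (growth_le_monSpan hV)).2 ⟨X i * f, Submodule.mul_mem_mul ?_ hf, ?_, ?_⟩
  · rw [mem_homogeneousSubmodule]; exact isHomogeneous_X K i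
  · exact mul_ne_zero (X_ne_zero i) h0
  · rw [MonomialOrder.degree_mul (X_ne_zero i) h0, MonomialOrder.degree_X, Finsupp.coe_add,
      Finsupp.single_eq_pi_single, add_comm]

/-- An optimal set of monomials spans a space with the smallest possible growth. -/
theorem Opt.finrank_growth_le {d : ℕ} {A : Finset (Fin n → ℕ)} (hA : Opt d A)
    {V : Submodule K (MvPolynomial (Fin n) K)} (hV : V ≤ homogeneousSubmodule (Fin n) K d)
    (h : Module.finrank K V = A.card) : (up A).card ≤ Module.finrank K (growth V) := by
  rw [← monSpan_mons] at hV
  obtain ⟨B, hB, hc⟩ := exists_subset_card_eq (h ▸ finrank_le_card_leads hV)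
  calc (up A).card ≤ (up B).card := hA.2 B (hB.trans (by classical exact filter_subset _ _)) hc
    _ ≤ (up (leads d V)).card := card_le_card (up_mono hB)
    _ ≤ (leads (d + 1) (growth V)).card := card_le_card (up_leads_subset hV)
    _ ≤ _ := card_leads_le_finrank (growth_le_monSpan hV)

end Monomials

/-! ### Monomial ideals -/

section Ideals

variable {K : Type*} [Field K] {n : ℕ}

theorem monomial_mem_span_iff {S : Set (Fin n →₀ ℕ)} {a : Fin n →₀ ℕ} :
    monomial a (1 : K) ∈ Ideal.span ((fun a => monomial a (1 : K)) '' S) ↔ ∃ b ∈ S, b ≤ a := by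
  classical
  rw [mem_ideal_span_monomial_image, support_monomial, if_neg one_ne_zero]
  simp

theorem mem_span_iff_forall_monomial_mem {S : Set (Fin n →₀ ℕ)} {f : MvPolynomial (Fin n) K} :
    f ∈ Ideal.span ((fun a => monomial a (1 : K)) '' S) ↔
      ∀ a ∈ f.support, monomial a (1 : K) ∈ Ideal.span ((fun a => monomial a (1 : K)) '' S) := by
  simp only [monomial_mem_span_iff]
  exact mem_ideal_span_monomial_image

attribute [local instance] MvPolynomial.gradedAlgebra

theorem isHomogeneous_span_monomial (S : Set (Fin n →₀ ℕ)) :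
    (Ideal.span ((fun a => monomial a (1 : K)) '' S)).IsHomogeneous
      (homogeneousSubmodule (Fin n) K) := by
  refine Ideal.homogeneous_span _ _ ?_
  rintro _ ⟨a, -, rfl⟩
  exact ⟨a.degree, isHomogeneous_monomial _ rfl⟩

theorem component_span_monomial {S : Set (Fin n →₀ ℕ)} {d : ℕ} {A : Finset (Fin n → ℕ)}
    (hA : ∀ a : Fin n →₀ ℕ, ⇑a ∈ A ↔ ⇑a ∈ mons n d ∧ ∃ b ∈ S, b ≤ a) :
    component (Ideal.span ((fun a => monomial a (1 : K)) '' S)) d = monSpan K A := by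
  ext f
  rw [component, Submodule.mem_inf, Submodule.restrictScalars_mem, ← monSpan_mons,
    mem_ideal_span_monomial_image, mem_monSpan, mem_monSpan, ← forall₂_and]
  exact forall₂_congr fun a _ => by rw [hA, and_comm]

/-- A set `B` of monomials of degree `d` is the whole degree `d` part of the ideal it generates, so
comparison with monomial ideals already yields optimality. Conversely, leading monomials reduce
arbitrary ideals to sets of monomials. -/
theorem isGotzmann_span_iff {S : Set (Fin n →₀ ℕ)} {A : ℕ → Finset (Fin n → ℕ)}
    (hA : ∀ d, ∀ a : Fin n →₀ ℕ, ⇑a ∈ A d ↔ ⇑a ∈ mons n d ∧ ∃ b ∈ S, b ≤ a) :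
    IsGotzmann (Ideal.span ((fun a => monomial a (1 : K)) '' S)) ↔ ∀ d, Opt d (A d) := by
  have hAs : ∀ d, A d ⊆ mons n d := fun d u hu =>
    ((hA d (Finsupp.equivFunOnFinite.symm u)).1 hu).1
  constructor
  · rintro ⟨-, h⟩ d
    refine ⟨hAs d, fun B hB hc => ?_⟩
    have hBc : ∀ a : Fin n →₀ ℕ, ⇑a ∈ B ↔
        ⇑a ∈ mons n d ∧ ∃ b ∈ {b : Fin n →₀ ℕ | ⇑b ∈ B}, b ≤ a := by
      intro a
      refine ⟨fun ha => ⟨hB ha, a, ha, le_rfl⟩, ?_⟩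
      rintro ⟨ha, b, hb, hba⟩
      have hb' := mem_mons.1 (hB hb)
      have : b = a := by
        ext i
        exact (sum_eq_sum_iff_of_le fun i _ => hba i).1 (hb'.trans (mem_mons.1 ha).symm) i
          (mem_univ i)
      exact this ▸ hb
    have := h d _ (isHomogeneous_span_monomial {b : Fin n →₀ ℕ | ⇑b ∈ B})
    rw [component_span_monomial (hA d), component_span_monomial hBc, growth_monSpan,
      growth_monSpan, finrank_monSpan, finrank_monSpan, finrank_monSpan, finrank_monSpan] at this
    exact this hc.symm
  · refine fun h => ⟨isHomogeneous_span_monomial S, fun d J _ hJ => ?_⟩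
    rw [component_span_monomial (hA d), finrank_monSpan] at hJ
    rw [component_span_monomial (hA d), growth_monSpan, finrank_monSpan]
    exact (h d).finrank_growth_le inf_le_right hJ.symm

/-! ### Squarefree ideals and their families -/

variable (K) in
/-- The ideal spanned by the monomials whose support belongs to `F`. -/
noncomputable def idl (F : Finset (Fin n) → Prop) : Ideal (MvPolynomial (Fin n) K) :=
  Ideal.span ((fun a => monomial a (1 : K)) '' {a : Fin n →₀ ℕ | F (supp a)})

theorem supp_mono {a b : Fin n →₀ ℕ} (h : a ≤ b) : supp ⇑a ⊆ supp ⇑b := by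
  intro i hi
  rw [mem_supp] at hi ⊢
  have := h i
  omega

theorem monomial_mem_idl {F : Finset (Fin n) → Prop} (hF : Monotone F) {a : Fin n →₀ ℕ} :
    monomial a (1 : K) ∈ idl K F ↔ F (supp a) := by
  rw [idl, monomial_mem_span_iff]
  constructor
  · rintro ⟨b, hb, hba⟩
    exact hF (supp_mono hba) hb
  · exact fun h => ⟨a, h, le_rfl⟩

theorem isGotzmann_idl_iff {F : Finset (Fin n) → Prop} (hF : Monotone F) :
    IsGotzmann (idl K F) ↔ Gotz F := by
  refine isGotzmann_span_iff fun d a => ?_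
  rw [mem_cmp, mem_mons]
  refine and_congr_right fun _ => ⟨fun h => ⟨a, h, le_rfl⟩, ?_⟩
  rintro ⟨b, hb, hba⟩
  exact hF (supp_mono hba) hb

/-- The exponent vector of the squarefree monomial with support `s`. -/
noncomputable def ind (s : Finset (Fin n)) : Fin n →₀ ℕ :=
  Finsupp.equivFunOnFinite.symm fun i => if i ∈ s then 1 else 0

theorem ind_apply (s : Finset (Fin n)) (i : Fin n) : ind s i = if i ∈ s then 1 else 0 := rfl

@[simp] theorem supp_ind (s : Finset (Fin n)) : supp (ind s) = s := by
  ext i; simp [ind_apply]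

theorem ind_le_iff {s : Finset (Fin n)} {a : Fin n →₀ ℕ} : ind s ≤ a ↔ s ⊆ supp a := by
  constructor
  · intro h
    simpa using supp_mono h
  · intro h i
    rw [ind_apply]
    split_ifs with hi
    · exact Nat.one_le_iff_ne_zero.2 (mem_supp.1 (h hi))
    · exact Nat.zero_le _

/-- The supports of the squarefree monomials in an ideal. -/
def famOf (I : Ideal (MvPolynomial (Fin n) K)) : Finset (Fin n) → Prop :=
  fun s => monomial (ind s) (1 : K) ∈ I

theorem monomial_mem_of_le {I : Ideal (MvPolynomial (Fin n) K)} {a b : Fin n →₀ ℕ}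
    (ha : monomial a (1 : K) ∈ I) (h : a ≤ b) : monomial b (1 : K) ∈ I := by
  obtain ⟨c, rfl⟩ := exists_add_of_le h
  have : monomial (a + c) (1 : K) = monomial c 1 * monomial a 1 := by
    rw [monomial_mul, one_mul, add_comm]
  rw [this]
  exact I.mul_mem_left _ ha

theorem famOf_mono (I : Ideal (MvPolynomial (Fin n) K)) : Monotone (famOf I) :=
  fun s t hst h => monomial_mem_of_le h (ind_le_iff.2 (by simpa using hst))

theorem famOf_idl {F : Finset (Fin n) → Prop} (hF : Monotone F) : famOf (idl K F) = F := by
  ext s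
  rw [famOf, monomial_mem_idl hF, supp_ind]

theorem exists_gens_le {I : Ideal (MvPolynomial (Fin n) K)} {a : Fin n →₀ ℕ}
    (ha : monomial a (1 : K) ∈ I) : ∃ b ∈ gens I, b ≤ a := by
  obtain ⟨b, hba, hb⟩ := exists_minimal_le_of_wellFoundedLT
    (fun b : Fin n →₀ ℕ => monomial b (1 : K) ∈ I) a ha
  exact ⟨b, hb, hba⟩

theorem isSquarefreeIdeal_idl {F : Finset (Fin n) → Prop} (hF : Monotone F) :
    IsSquarefreeIdeal (idl K F) := by
  refine ⟨⟨_, rfl⟩, fun a ha i => ?_⟩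
  have h1 : monomial (ind (supp a)) (1 : K) ∈ idl K F := by
    rw [monomial_mem_idl hF, supp_ind, ← monomial_mem_idl (K := K) hF]
    exact ha.1
  have h2 := ha.2 h1 (ind_le_iff.2 subset_rfl) i
  rw [ind_apply] at h2
  split_ifs at h2 <;> omega

/-- A squarefree generator divides a monomial exactly when it divides its radical, so membership of
a monomial depends only on its support. -/
theorem IsSquarefreeIdeal.eq_idl {I : Ideal (MvPolynomial (Fin n) K)}
    (hI : IsSquarefreeIdeal I) : I = idl K (famOf I) := by
  have key : ∀ a : Fin n →₀ ℕ, monomial a (1 : K) ∈ I ↔ monomial a (1 : K) ∈ idl K (famOf I) := by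
    intro a
    rw [monomial_mem_idl (famOf_mono I)]
    constructor
    · intro h
      obtain ⟨b, hb, hba⟩ := exists_gens_le h
      refine monomial_mem_of_le hb.1 fun i => ?_
      have h1 := hI.2 b hb i
      have h2 := hba i
      rw [ind_apply]
      split_ifs with hi
      · exact h1
      · rw [mem_supp, not_not] at hi
        omega
    · exact fun h => monomial_mem_of_le h (ind_le_iff.2 subset_rfl)
  obtain ⟨S, hS⟩ := hI.1
  ext f
  rw [idl, mem_span_iff_forall_monomial_mem]
  change _ ↔ ∀ a ∈ f.support, monomial a (1 : K) ∈ idl K (famOf I)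
  simp only [← key]
  rw [hS]
  exact mem_span_iff_forall_monomial_mem

theorem famOf_empty_iff {I : Ideal (MvPolynomial (Fin n) K)} : famOf I ∅ ↔ I = ⊤ := by
  have : ind (∅ : Finset (Fin n)) = 0 := by ext i; simp [ind_apply]
  rw [famOf, this, Ideal.eq_top_iff_one]
  rfl

theorem hasLinearForm_idl_iff {F : Finset (Fin n) → Prop} (hF : Monotone F) :
    HasLinearForm (idl K F) ↔ ∃ i, F {i} := by
  have hs : ∀ i : Fin n, supp ⇑(Finsupp.single i 1) = {i} := by
    intro i; ext k; simp [Finsupp.single_apply, eq_comm]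
  constructor
  · rintro ⟨f, hf, h0, h1⟩
    obtain ⟨a, ha⟩ := support_nonempty.2 h0
    have h2 := mem_span_iff_forall_monomial_mem.1 hf a ha
    rw [← mem_homogeneousSubmodule, ← monSpan_mons, mem_monSpan] at h1
    have ha1 : a.degree = 1 := by rw [Finsupp.degree_eq_sum]; exact mem_mons.1 (h1 a ha)
    obtain ⟨i, rfl⟩ : a ∈ Set.range fun i : Fin n => Finsupp.single i 1 := by
      rw [Finsupp.range_single_one]; exact ha1
    refine ⟨i, ?_⟩
    rw [← hs]
    exact (monomial_mem_idl hF).1 h2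
  · rintro ⟨i, hi⟩
    refine ⟨X i, (monomial_mem_idl hF).2 (by rwa [hs]), X_ne_zero i, isHomogeneous_X K i⟩

theorem inMonomialSubalgebra_idl_iff {F : Finset (Fin n) → Prop} (hF : Monotone F) :
    InMonomialSubalgebra (idl K F) ↔ ∃ i, ∀ s, F s → F (s.erase i) := by
  have hsup : ∀ (a : Fin n →₀ ℕ) (A : Set (Fin n)),
      monomial a (1 : K) ∈ supported K A ↔ ∀ i, a i ≠ 0 → i ∈ A := by
    intro a A
    rw [mem_supported, vars_monomial one_ne_zero]
    exact forall_congr' fun i => by simp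
  constructor
  · rintro ⟨A, hA, h⟩
    obtain ⟨i, hi⟩ := (Set.ne_univ_iff_exists_notMem A).1 hA
    refine ⟨i, fun s hs => ?_⟩
    have hmem : monomial (ind s) (1 : K) ∈ idl K F := (monomial_mem_idl hF).2 (by simpa using hs)
    obtain ⟨b, hb, hbs⟩ := exists_gens_le hmem
    refine hF ?_ ((monomial_mem_idl (K := K) hF).1 hb.1)
    intro k hk
    refine mem_erase.2 ⟨fun hki => hi (hki ▸ (hsup b A).1 (h b hb) k (mem_supp.1 hk)), ?_⟩
    simpa using supp_mono hbs hk
  · rintro ⟨i, hi⟩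
    refine ⟨{i}ᶜ, by simp, fun a ha => (hsup _ _).2 fun k hk => ?_⟩
    rw [Set.mem_compl_iff, Set.mem_singleton_iff]
    rintro rfl
    have h1 : monomial (a.erase k) (1 : K) ∈ idl K F := by
      rw [monomial_mem_idl hF]
      have : supp ⇑(a.erase k) = (supp a).erase k := by
        ext m; simp [Finsupp.erase_apply]
      rw [this]
      exact hi _ ((monomial_mem_idl (K := K) hF).1 ha.1)
    have hle : a.erase k ≤ a := by
      intro m
      rw [Finsupp.erase_apply]
      split_ifs
      · exact Nat.zero_le _
      · exact le_rfl
    have := ha.2 h1 hle k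
    simp at this
    exact hk this

theorem famOf_map (I : Ideal (MvPolynomial (Fin n) K)) (σ : Equiv.Perm (Fin n))
    (s : Finset (Fin n)) :
    famOf I s ↔ famOf (I.map (renameEquiv K σ)) (s.map σ.toEmbedding) := by
  have h1 : renameEquiv K σ (monomial (ind s) (1 : K)) =
      monomial (ind (s.map σ.toEmbedding)) 1 := by
    rw [renameEquiv_apply, rename_monomial]
    refine congrArg (fun a => monomial a (1 : K)) (Finsupp.ext fun i => ?_)
    obtain ⟨i, rfl⟩ := σ.surjective i
    rw [Finsupp.mapDomain_apply σ.injective, ind_apply, ind_apply]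
    simp
  rw [famOf, famOf, ← h1, Ideal.mem_map_of_equiv]
  refine ⟨fun h => ⟨_, h, rfl⟩, ?_⟩
  rintro ⟨f, hf, h⟩
  rwa [← (renameEquiv K σ).injective h]

theorem idl_map (F G : Finset (Fin n) → Prop) (σ : Equiv.Perm (Fin n))
    (h : ∀ s, F s ↔ G (s.map σ.toEmbedding)) : (idl K F).map (renameEquiv K σ) = idl K G := by
  rw [idl, idl, Ideal.map_span, ← Set.image_comp]
  congr 1
  have hs : ∀ a : Fin n →₀ ℕ, supp ⇑(a.mapDomain σ) = (supp a).map σ.toEmbedding := by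
    intro a
    ext i
    obtain ⟨i, rfl⟩ := σ.surjective i
    rw [mem_supp, Finsupp.mapDomain_apply σ.injective]
    simp
  ext f
  constructor
  · rintro ⟨a, ha, rfl⟩
    refine ⟨a.mapDomain σ, ?_, ?_⟩
    · rw [Set.mem_ofPred_eq, hs, ← h]; exact ha
    · simp [rename_monomial]
  · rintro ⟨b, hb, rfl⟩
    refine ⟨b.mapDomain σ.symm, ?_, ?_⟩
    · have hb' : (b.mapDomain σ.symm).mapDomain σ = b := by
        rw [← Finsupp.mapDomain_comp]; simp
      rw [Set.mem_ofPred_eq, h, ← hs, hb']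
      exact hb
    · simp [rename_monomial, ← Finsupp.mapDomain_comp]

end Ideals

end SqfGotzmann

namespace SqfGotzmann

open Finset MvPolynomial

/-! ### Counting -/

section Counting

variable {K : Type*} [Field K] {n : ℕ}

/-- The code `k` of the ideal is not a choice: it is the number of its squarefree monomials. -/
theorem famCard_famOf_lt {I : Ideal (MvPolynomial (Fin n) K)} (hI : I ≠ ⊤)
    (hS : IsSquarefreeIdeal I) (hG : IsGotzmann I) :
    famCard (famOf I) < 2 ^ n ∧ ∃ σ : Equiv.Perm (Fin n),
      ∀ s, famOf I s ↔ fam n (famCard (famOf I)) (s.map σ.toEmbedding) := by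
  rw [hS.eq_idl, isGotzmann_idl_iff (famOf_mono I)] at hG
  obtain ⟨k, hk, σ, h⟩ := hG.exists_fam (famOf_mono I) (famOf_empty_iff.not.2 hI)
  have := famCard_congr σ h
  rw [famCard_fam hk] at this
  rw [this]
  exact ⟨hk, σ, h⟩

theorem hasLinearForm_iff {I : Ideal (MvPolynomial (Fin (n + 1)) K)} (hI : I ≠ ⊤)
    (hS : IsSquarefreeIdeal I) (hG : IsGotzmann I) :
    HasLinearForm I ↔ 2 ^ n ≤ famCard (famOf I) := by
  obtain ⟨-, σ, h⟩ := famCard_famOf_lt hI hS hG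
  rw [← exists_fam_singleton_iff]
  conv_lhs => rw [hS.eq_idl, hasLinearForm_idl_iff (famOf_mono I)]
  refine σ.exists_congr fun i => ?_
  rw [h, map_singleton]
  rfl

theorem inMonomialSubalgebra_iff {I : Ideal (MvPolynomial (Fin (n + 1)) K)} (hI : I ≠ ⊤)
    (hS : IsSquarefreeIdeal I) (hG : IsGotzmann I) :
    InMonomialSubalgebra I ↔ Even (famCard (famOf I)) := by
  obtain ⟨hk, σ, h⟩ := famCard_famOf_lt hI hS hG
  rw [← exists_fam_erase_iff hk]
  conv_lhs => rw [hS.eq_idl, inMonomialSubalgebra_idl_iff (famOf_mono I)]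
  refine σ.exists_congr fun i => σ.finsetCongr.forall_congr fun {s} => ?_
  rw [h, h, map_erase]
  rfl

/-- Squarefree Gotzmann ideals are determined up to reordering by the number of their squarefree
monomials. -/
theorem countUpToReordering_eq {C : Set (Ideal (MvPolynomial (Fin n) K))}
    (hC : ∀ I ∈ C, I ≠ ⊤ ∧ IsSquarefreeIdeal I ∧ IsGotzmann I) :
    countUpToReordering C = ((fun I => famCard (famOf I)) '' C).ncard := by
  let κ : Quotient (reorderingSetoid K n) → ℕ := Quotient.lift (fun I => famCard (famOf I)) (by
    rintro I J ⟨σ, rfl⟩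
    exact famCard_congr σ (famOf_map I σ))
  have hinj : Set.InjOn κ (Quotient.mk (reorderingSetoid K n) '' C) := by
    rintro _ ⟨I, hI, rfl⟩ _ ⟨J, hJ, rfl⟩ h
    change famCard (famOf I) = famCard (famOf J) at h
    obtain ⟨hI1, hI2, hI3⟩ := hC I hI
    obtain ⟨hJ1, hJ2, hJ3⟩ := hC J hJ
    obtain ⟨-, σ, hσ⟩ := famCard_famOf_lt hI1 hI2 hI3
    obtain ⟨-, τ, hτ⟩ := famCard_famOf_lt hJ1 hJ2 hJ3
    refine Quotient.sound ⟨σ.trans τ.symm, ?_⟩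
    rw [hI2.eq_idl, hJ2.eq_idl]
    refine (idl_map _ _ _ fun s => ?_).symm
    rw [hσ, hτ, h, map_map]
    have : (σ.trans τ.symm).toEmbedding.trans τ.toEmbedding = σ.toEmbedding := by
      ext i; simp
    rw [this]
  rw [countUpToReordering, ← hinj.ncard_image, ← Set.image_comp]
  rfl

/-- Turns the count of a class of ideals into a count of codes, each code below `2 ^ n` being
realized by the ideal of `fam n k`. -/
theorem countUpToReordering_of_iff {Q : Ideal (MvPolynomial (Fin n) K) → Prop} {P : ℕ → Prop}
    (h : ∀ I, I ≠ ⊤ → IsSquarefreeIdeal I → IsGotzmann I → (Q I ↔ P (famCard (famOf I)))) :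
    countUpToReordering {I : Ideal (MvPolynomial (Fin n) K) |
      I ≠ ⊤ ∧ IsSquarefreeIdeal I ∧ IsGotzmann I ∧ Q I} = {k | k < 2 ^ n ∧ P k}.ncard := by
  rw [countUpToReordering_eq fun I hI => ⟨hI.1, hI.2.1, hI.2.2.1⟩]
  congr 1
  ext k
  constructor
  · rintro ⟨I, ⟨h1, h2, h3, h4⟩, rfl⟩
    exact ⟨(famCard_famOf_lt h1 h2 h3).1, (h I h1 h2 h3).1 h4⟩
  · rintro ⟨hk, hP⟩
    have hm := fam_mono n k
    have hf : famOf (idl K (fam n k)) = fam n k := famOf_idl hm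
    have h1 : idl K (fam n k) ≠ ⊤ := by
      rw [ne_eq, ← famOf_empty_iff, hf]; exact not_fam_empty n k
    have h2 : IsSquarefreeIdeal (idl K (fam n k)) := isSquarefreeIdeal_idl hm
    have h3 : IsGotzmann (idl K (fam n k)) := (isGotzmann_idl_iff hm).2 (gotz_fam hk)
    have hc : famCard (famOf (idl K (fam n k))) = k := by rw [hf, famCard_fam hk]
    exact ⟨idl K (fam n k), ⟨h1, h2, h3, (h _ h1 h2 h3).2 (by rwa [hc])⟩, hc⟩

theorem hasLinearForm_top : HasLinearForm (⊤ : Ideal (MvPolynomial (Fin (n + 1)) K)) :=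
  ⟨X 0, Submodule.mem_top, X_ne_zero 0, isHomogeneous_X K 0⟩

end Counting

theorem ncard_arith_progression (a m : ℕ) {S : Set ℕ}
    (hS : ∀ k, k ∈ S ↔ ∃ j < m, a + 2 * j = k) : S.ncard = m := by
  have : S = (fun j => a + 2 * j) '' (range m : Finset ℕ) := by
    ext k
    rw [hS]
    simp
  rw [this, Set.ncard_image_of_injective _ fun i j h => by simpa using h, Set.ncard_coe_finset,
    card_range]

/-! ### Compositions -/

theorem length_compositionEquiv_symm {m : ℕ} (s : Finset (Fin (m + 1))) :
    ((compositionEquiv (m + 2)).symm ((compositionAsSetEquiv (m + 2)).symm s)).length =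
      s.card + 1 := by
  change (((compositionAsSetEquiv (m + 2)).symm s).toComposition).length = _
  rw [CompositionAsSet.toComposition_length]
  have h1 := ((compositionAsSetEquiv (m + 2)).symm s).card_boundaries_eq_succ_length
  -- The boundaries are the two endpoints and the interior cut points in `s`, whose indices are
  -- shifted by one.
  have h2 : ((compositionAsSetEquiv (m + 2)).symm s).boundaries =
      insert 0 (insert (Fin.last (m + 2)) (s.map (Fin.castSuccEmb.trans (Fin.succEmb (m + 2))))) := by
    ext i
    simp only [compositionAsSetEquiv, Equiv.coe_fn_symm_mk, Set.mem_toFinset, Set.mem_ofPred_eq,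
      mem_insert, mem_map]
    refine or_congr Iff.rfl (or_congr Iff.rfl ⟨?_, ?_⟩)
    · rintro ⟨j, hj, h⟩
      exact ⟨j, hj, Fin.ext h.symm⟩
    · rintro ⟨j, hj, rfl⟩
      exact ⟨j, hj, rfl⟩
  rw [h2, card_insert_of_notMem, card_insert_of_notMem, card_map] at h1
  · change _ = CompositionAsSet.length _ + 1 at h1
    omega
  · simp only [mem_map, not_exists, not_and]
    intro j _ h
    have := congrArg Fin.val h
    simp at this
    omega
  · simp only [mem_insert, mem_map, not_or, not_exists, not_and]
    refine ⟨fun h => absurd (congrArg Fin.val h) (by simp), fun j _ h => ?_⟩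
    exact absurd (congrArg Fin.val h) (by simp)

theorem famCard_add_famCard_not {n : ℕ} (F : Finset (Fin n) → Prop) :
    famCard F + famCard (fun s => ¬ F s) = 2 ^ n := by
  classical
  rw [famCard, famCard]
  convert card_filter_add_card_filter_not (s := (univ : Finset (Finset (Fin n)))) F
  simp

/-- Inserting variable `0` flips parity, so either parity class has as many sets as there are
subsets of the remaining `m` elements. -/
theorem famCard_even (m : ℕ) : famCard (fun s : Finset (Fin (m + 1)) => Even s.card) = 2 ^ m ∧
    famCard (fun s : Finset (Fin (m + 1)) => Odd s.card) = 2 ^ m := by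
  have h := famCard_add_famCard_not fun s : Finset (Fin m) => Even s.card
  have h' : famCard (fun s : Finset (Fin m) => ¬ Even s.card) + famCard (fun s : Finset (Fin m) =>
      Even s.card) = 2 ^ m := by rw [add_comm, h]
  constructor
  · rw [famCard_eq 0, ← h]
    congr 2
    · funext s; simp [del]
    · funext s
      rw [lk, card_insert_of_notMem (notMem_map_succAbove _ _), card_map, Nat.even_add_one]
  · rw [famCard_eq 0, ← h']
    congr 2
    · funext s; simp [del]
    · funext s
      rw [lk, card_insert_of_notMem (notMem_map_succAbove _ _), card_map, Nat.odd_add_one,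
        Nat.not_odd_iff_even]

theorem natCard_composition {m : ℕ} (P : ℕ → Prop) :
    Nat.card {c : Composition (m + 2) // P c.length} =
      famCard (fun s : Finset (Fin (m + 1)) => P (s.card + 1)) := by
  classical
  let e := (compositionEquiv (m + 2)).trans (compositionAsSetEquiv (m + 2))
  have he : ∀ c, P (Composition.length c) ↔ P ((e c).card + 1) := by
    intro c
    obtain ⟨s, rfl⟩ := e.symm.surjective c
    rw [Equiv.apply_symm_apply]
    change P (((compositionEquiv (m + 2)).symm ((compositionAsSetEquiv (m + 2)).symm s)).length) ↔ _
    rw [length_compositionEquiv_symm]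
  rw [Nat.card_congr (e.subtypeEquiv (q := fun s => P (s.card + 1)) he),
    Nat.card_eq_fintype_card, Fintype.card_subtype, famCard]
  congr 1

end SqfGotzmann

/-! ### The six counts and the total -/

theorem mainTheorem8 (K : Type*) [Field K] (n : ℕ) (hn : 1 ≤ n) :
    (2 ≤ n →
      Nat.card {c : Composition n // Even c.length} = 2 ^ (n - 2) ∧
      Nat.card {c : Composition n // Odd c.length} = 2 ^ (n - 2) ∧
      SqfGotzmann.countUpToReordering
        {I : Ideal (MvPolynomial (Fin n) K) |
          SqfGotzmann.IsSquarefreeIdeal I ∧ SqfGotzmann.IsGotzmann I ∧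
          ¬ SqfGotzmann.HasLinearForm I ∧ ¬ SqfGotzmann.InMonomialSubalgebra I} = 2 ^ (n - 2) ∧
      SqfGotzmann.countUpToReordering
        {I : Ideal (MvPolynomial (Fin n) K) |
          I ≠ ⊤ ∧ SqfGotzmann.IsSquarefreeIdeal I ∧ SqfGotzmann.IsGotzmann I ∧
          SqfGotzmann.HasLinearForm I ∧ ¬ SqfGotzmann.InMonomialSubalgebra I} = 2 ^ (n - 2) ∧
      SqfGotzmann.countUpToReordering
        {I : Ideal (MvPolynomial (Fin n) K) |
          SqfGotzmann.IsSquarefreeIdeal I ∧ SqfGotzmann.IsGotzmann I ∧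
          ¬ SqfGotzmann.HasLinearForm I ∧ SqfGotzmann.InMonomialSubalgebra I} = 2 ^ (n - 2) ∧
      SqfGotzmann.countUpToReordering
        {I : Ideal (MvPolynomial (Fin n) K) |
          I ≠ ⊤ ∧ SqfGotzmann.IsSquarefreeIdeal I ∧ SqfGotzmann.IsGotzmann I ∧
          SqfGotzmann.HasLinearForm I ∧ SqfGotzmann.InMonomialSubalgebra I} = 2 ^ (n - 2)) ∧
    SqfGotzmann.countUpToReordering
      {I : Ideal (MvPolynomial (Fin n) K) |
        I ≠ ⊤ ∧ SqfGotzmann.IsSquarefreeIdeal I ∧ SqfGotzmann.IsGotzmann I} = 2 ^ n := by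
  constructor
  · intro h2
    obtain ⟨m, rfl⟩ : ∃ m, n = m + 2 := ⟨n - 2, by omega⟩
    -- The unit ideal contains linear forms, so in the classes without linear forms properness is
    -- automatic.
    have hnt : ∀ Q : Ideal (MvPolynomial (Fin (m + 2)) K) → Prop,
        {I : Ideal (MvPolynomial (Fin (m + 2)) K) | SqfGotzmann.IsSquarefreeIdeal I ∧
          SqfGotzmann.IsGotzmann I ∧ ¬ SqfGotzmann.HasLinearForm I ∧ Q I} =
        {I | I ≠ ⊤ ∧ SqfGotzmann.IsSquarefreeIdeal I ∧ SqfGotzmann.IsGotzmann I ∧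
          ¬ SqfGotzmann.HasLinearForm I ∧ Q I} := by
      intro Q
      ext I
      refine ⟨fun h => ⟨?_, h⟩, fun h => h.2⟩
      rintro rfl
      exact h.2.2.1 SqfGotzmann.hasLinearForm_top
    have hp : 2 ^ (m + 2) = 4 * 2 ^ m := by ring
    have hp' : 2 ^ (m + 1) = 2 * 2 ^ m := by ring
    rw [Nat.add_sub_cancel, hnt, hnt]
    -- The number of parts exceeds the number of cuts by one, so parities swap for compositions. For
    -- ideals, fixing the top digit and the parity leaves an arithmetic progression of step two with
    -- `2 ^ m` terms.
    refine ⟨?_, ?_, ?_, ?_, ?_, ?_⟩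
    · rw [SqfGotzmann.natCard_composition, ← (SqfGotzmann.famCard_even m).2]
      simp only [Nat.even_add_one, Nat.not_even_iff_odd]
    · rw [SqfGotzmann.natCard_composition, ← (SqfGotzmann.famCard_even m).1]
      simp only [Nat.odd_add_one, Nat.not_odd_iff_even]
    · rw [SqfGotzmann.countUpToReordering_of_iff (P := fun k => ¬ 2 ^ (m + 1) ≤ k ∧ ¬ Even k)
        fun I h1 h2 h3 => and_congr (SqfGotzmann.hasLinearForm_iff h1 h2 h3).not
          (SqfGotzmann.inMonomialSubalgebra_iff h1 h2 h3).not]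
      refine SqfGotzmann.ncard_arith_progression 1 _ fun k => ?_
      simp only [Set.mem_ofPred_eq, Nat.not_even_iff]
      exact ⟨fun h => ⟨k / 2, by omega, by omega⟩, by rintro ⟨j, hj, rfl⟩; omega⟩
    · rw [SqfGotzmann.countUpToReordering_of_iff (P := fun k => 2 ^ (m + 1) ≤ k ∧ ¬ Even k)
        fun I h1 h2 h3 => and_congr (SqfGotzmann.hasLinearForm_iff h1 h2 h3)
          (SqfGotzmann.inMonomialSubalgebra_iff h1 h2 h3).not]
      refine SqfGotzmann.ncard_arith_progression (2 * 2 ^ m + 1) _ fun k => ?_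
      simp only [Set.mem_ofPred_eq, Nat.not_even_iff]
      exact ⟨fun h => ⟨(k - 2 * 2 ^ m) / 2, by omega, by omega⟩, by rintro ⟨j, hj, rfl⟩; omega⟩
    · rw [SqfGotzmann.countUpToReordering_of_iff (P := fun k => ¬ 2 ^ (m + 1) ≤ k ∧ Even k)
        fun I h1 h2 h3 => and_congr (SqfGotzmann.hasLinearForm_iff h1 h2 h3).not
          (SqfGotzmann.inMonomialSubalgebra_iff h1 h2 h3)]
      refine SqfGotzmann.ncard_arith_progression 0 _ fun k => ?_
      simp only [Set.mem_ofPred_eq, Nat.even_iff]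
      exact ⟨fun h => ⟨k / 2, by omega, by omega⟩, by rintro ⟨j, hj, rfl⟩; omega⟩
    · rw [SqfGotzmann.countUpToReordering_of_iff (P := fun k => 2 ^ (m + 1) ≤ k ∧ Even k)
        fun I h1 h2 h3 => and_congr (SqfGotzmann.hasLinearForm_iff h1 h2 h3)
          (SqfGotzmann.inMonomialSubalgebra_iff h1 h2 h3)]
      refine SqfGotzmann.ncard_arith_progression (2 * 2 ^ m) _ fun k => ?_
      simp only [Set.mem_ofPred_eq, Nat.even_iff]
      exact ⟨fun h => ⟨(k - 2 * 2 ^ m) / 2, by omega, by omega⟩, by rintro ⟨j, hj, rfl⟩; omega⟩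
  · have := SqfGotzmann.countUpToReordering_of_iff (K := K) (n := n) (Q := fun _ => True)
      (P := fun _ => True) fun _ _ _ _ => Iff.rfl
    simp only [and_true] at this
    rw [this]
    have h : {k | k < 2 ^ n} = ((Finset.range (2 ^ n) : Finset ℕ) : Set ℕ) := by ext; simp
    rw [h, Set.ncard_coe_finset, Finset.card_range]
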